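/- Let $d\in\{1,2,3\}$, let $\Omega\subset\mathbb R^d$ be a bounded open set (no regularity of $\partial\Omega$ is needed), let $T>0$, $\ell\ge 1$, $0<\alpha_\ell<\dots<\alpha_2<\alpha_1<1$, and let $q_1,\dots,q_\ell\in C[0,T]$ satisfy $q_i\ge 0$ and $\sum_{i=1}^{\ell}q_i>0$ on $[0,T]$. Write $\|\cdot\|$ for the norm of $L_2(\Omega)$. For $y\in C([0,T];L_2(\Omega))$ that is Lipschitz on $[\epsilon,T]$ for each $\epsilon\in(0,T]$, define the Caputo derivative by $$\Gamma(1-\alpha)\,D_t^{\alpha}y(t)=t^{-\alpha}\,[y(t)-y(0)]+\int_0^t\alpha\,(t-s)^{-\alpha-1}\,[y(t)-y(s)]\,ds,\qquad 0<t\le T,\ 0<\alpha<1 .$$ Let $\mathcal L u=-\sum_i\partial_i\bigl(\sum_j a_{ij}\partial_j u+p_i u\bigr)+\sum_i b_i\partial_i u+cu$ be a uniformly elliptic operator whose coefficients are bounded measurable functions of $x\in\Omega$, understood in the weak sense, and suppose that $\langle\mathcal L r,r\rangle\ge\lambda\|r\|^2$ for all $r\in H^1_0(\Omega)$, where $\lambda\ge0$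 is a constant. Let $f(\cdot,t)$ be locally integrable on $\Omega$ for each $t\in(0,T]$, let $u_0\in L_2(\Omega)$, and let $u$ be a solution of $$\sum_{i=1}^{\ell}q_i(t)\,D_t^{\alpha_i}u+\mathcal L u=f\ \text{ in }\Omega\times(0,T],\qquad u(\cdot,0)=u_0,\qquad u=0\ \text{ on }\partial\Omega\times(0,T],$$ where for each $t\in(0,T]$ the equation holds in the sense of distributions on $\Omega$ and the boundary condition means $u(\cdot,t)\in H^1_0(\Omega)$. Let $u_h$ satisfy $u_h(\cdot,0)=u(\cdot,0)$ and $u_h(\cdot,t)\in H_0^1(\Omega)$ for $t\in(0,T]$, and suppose that $u$ and $u_h$ lie in $C([0,T];L_2(\Omega))\cap W^{1,\infty}(\epsilon,T;L_2(\Omega))$ for each $\epsilon\in(0,T]$. Let $$R_h(\cdot,t):=\Bigl(\sum_{i=1}^{\ell}q_i(t)\,D_t^{\alpha_i}+\mathcal L\Bigr)u_h(\cdot,t)-f(\cdot,t),\qquad 0<t\le T,$$ where $\|R_h(\cdot,t)\|:=\infty$ if $R_h(\cdot,t)\notin L_2(\Omega)$. Let $\tau>0$ be arbitrary, and put $\beta:=1-\alpha_1$,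 $\mathcal E_1(t):=(\max\{\tau,t\})^{\alpha_1-1}$ for $t>0$, $\mathcal E_1(0):=0$, and $$\mathcal R_1(t):=\lambda\,\mathcal E_1(t)+\tau^{-\beta}\sum_{i=1}^{\ell}\frac{q_i(t)\,t^{-\alpha_i}}{\Gamma(1-\alpha_i)}\,\bigl[1-\rho_i(\tau/t)\bigr],$$ where $\rho_i(s):=0$ for $s\ge1$ and $$\rho_i(s):={}_2F_1(\alpha_i,-\beta;\alpha_1;s)-\frac{\Gamma(\alpha_1)\,\Gamma(1-\alpha_i)}{\Gamma(\alpha_1-\alpha_i)}\,s^{\beta}\qquad\text{for }0<s<1,$$ with $1/\Gamma(0):=0$ for $i=1$. Then $$\rho_i(s)\le(1-s)^{1-\alpha_i}<1\qquad\text{for }s\in(0,1),\ i=1,\dots,\ell,$$ and, for all $t\in(0,T]$, $$\|(u_h-u)(\cdot,t)\|\le t^{\alpha_1-1}\sup_{0<s\le t}\frac{\|R_h(\cdot,s)\|}{\mathcal R_1(s)} .$$ The latter bound also holds with the factor $t^{\alpha_1-1}$ replaced by $\mathcal E_1(t)$. -/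

import Mathlib

open Set MeasureTheory
open scoped ENNReal

noncomputable section

namespace Subdiffusion

/-- `φ ∈ C_c^∞(U)`: smooth with compact support contained in `U`. -/
structure IsTestFunction {V : Type*} [NormedAddCommGroup V] [NormedSpace ℝ V]
    (U : Set V) (φ : V → ℝ) : Prop where
  smooth : ContDiff ℝ ((⊤ : ℕ∞) : WithTop ℕ∞) φ
  compactSupport : HasCompactSupport φ
  support_subset : tsupport φ ⊆ U

/-- `y ∈ W^{1,∞}(a, b; X)`: `y` and its weak derivative `y'` belong to `L^∞(a, b; X)`. -/
def MemW1Infty {X : Type*} [NormedAddCommGroup X] [NormedSpace ℝ X]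
    (a b : ℝ) (y : ℝ → X) : Prop :=
  MemLp y ⊤ (volume.restrict (Ioo a b)) ∧
    ∃ y' : ℝ → X, MemLp y' ⊤ (volume.restrict (Ioo a b)) ∧
      ∀ φ : ℝ → ℝ, IsTestFunction (Ioo a b) φ →
        ∫ t in Ioo a b, deriv φ t • y t = -∫ t in Ioo a b, φ t • y' t

/-- `y ∈ C([0, T]; X) ∩ W^{1,∞}(ε, T; X)` for each `ε ∈ (0, T]`. -/
def TimeRegular {X : Type*} [NormedAddCommGroup X] [NormedSpace ℝ X]
    (T : ℝ) (y : ℝ → X) : Prop :=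
  ContinuousOn y (Icc 0 T) ∧ ∀ ε ∈ Ioc 0 T, MemW1Infty ε T y

/-- The Caputo derivative `D_t^α y (t)` of order `0 < α < 1`, in the form obtained by integration
by parts; it is defined for all `y` that are continuous at `0` and locally Lipschitz on `(0, T]`. -/
def caputo {X : Type*} [NormedAddCommGroup X] [NormedSpace ℝ X]
    (α : ℝ) (y : ℝ → X) (t : ℝ) : X :=
  (Real.Gamma (1 - α))⁻¹ •
    (t ^ (-α) • (y t - y 0) + ∫ s in (0 : ℝ)..t, (α * (t - s) ^ (-α - 1)) • (y t - y s))

/-- The multiterm operator `∑ i, q_i(t) D_t^{α_i} y (t)`. -/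
def multiCaputo {X : Type*} [NormedAddCommGroup X] [NormedSpace ℝ X] {ℓ : ℕ}
    (α : Fin ℓ → ℝ) (q : Fin ℓ → ℝ → ℝ) (y : ℝ → X) (t : ℝ) : X :=
  ∑ i, q i t • caputo (α i) y t

/-- `ℝ^d` with its Euclidean norm. -/
abbrev Space (d : ℕ) : Type := EuclideanSpace ℝ (Fin d)

/-- The real Hilbert space `L_2(Ω)`. -/
abbrev L2 {d : ℕ} (Ω : Set (Space d)) : Type := Lp ℝ 2 (volume.restrict Ω)

/-- `u ∈ H^1(Ω)` with weak gradient `G ∈ L_2(Ω)^d`. -/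
def HasWeakGradient {d : ℕ} (Ω : Set (Space d)) (u : Space d → ℝ) (G : Space d → Space d) :
    Prop :=
  MemLp u 2 (volume.restrict Ω) ∧ MemLp G 2 (volume.restrict Ω) ∧
    ∀ φ : Space d → ℝ, IsTestFunction Ω φ →
      ∫ x in Ω, u x • gradient φ x = -∫ x in Ω, φ x • G x

open Classical in
/-- The weak gradient of `u ∈ H^1(Ω)`, which is unique almost everywhere
(`0` if `u` is not in `H^1(Ω)`). -/
def weakGradient {d : ℕ} (Ω : Set (Space d)) (u : Space d → ℝ) : Space d → Space d :=
  if h : ∃ G, HasWeakGradient Ω u G then h.choose else 0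

/-- `u ∈ H^1_0(Ω)`, the closure of `C_c^∞(Ω)` in `H^1(Ω)`. -/
def MemH10 {d : ℕ} (Ω : Set (Space d)) (u : Space d → ℝ) : Prop :=
  ∃ G, HasWeakGradient Ω u G ∧
    ∀ ε : ℝ≥0∞, 0 < ε → ∃ φ : Space d → ℝ, IsTestFunction Ω φ ∧
      eLpNorm (fun x => u x - φ x) 2 (volume.restrict Ω) ≤ ε ∧
      eLpNorm (fun x => G x - gradient φ x) 2 (volume.restrict Ω) ≤ ε

/-- A linear second-order uniformly elliptic operator with bounded measurable coefficients,
`𝓛 u = - ∑ i, ∂_i (∑ j, a_{ij} ∂_j u + p_i u) + ∑ i, b_i ∂_i u + c u`. -/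
structure EllipticOperator {d : ℕ} (Ω : Set (Space d)) where
  a : Fin d → Fin d → Space d → ℝ
  p : Fin d → Space d → ℝ
  b : Fin d → Space d → ℝ
  c : Space d → ℝ
  a_bdd : ∀ i j, MemLp (a i j) ⊤ (volume.restrict Ω)
  p_bdd : ∀ i, MemLp (p i) ⊤ (volume.restrict Ω)
  b_bdd : ∀ i, MemLp (b i) ⊤ (volume.restrict Ω)
  c_bdd : MemLp c ⊤ (volume.restrict Ω)
  elliptic : ∃ θ : ℝ, 0 < θ ∧ ∀ᵐ x ∂(volume.restrict Ω), ∀ ξ : Space d,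
    θ * ‖ξ‖ ^ 2 ≤ ∑ i, ∑ j, a i j x * ξ j * ξ i

/-- The pairing `⟨𝓛 u, v⟩` for `u, v ∈ H^1_0(Ω)`. -/
def EllipticOperator.pairing {d : ℕ} {Ω : Set (Space d)} (L : EllipticOperator Ω)
    (u v : Space d → ℝ) : ℝ :=
  ∫ x in Ω, ((∑ i, ∑ j, L.a i j x * weakGradient Ω u x j * weakGradient Ω v x i)
    + (∑ i, L.p i x * u x * weakGradient Ω v x i)
    + (∑ i, L.b i x * weakGradient Ω u x i * v x)
    + L.c x * u x * v x)

/-- The distribution `(∑ i, q_i(t) D_t^{α_i} + 𝓛) y (·, t)` on `Ω`, evaluated at the test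
function `φ`. -/
def operatorPairing {d ℓ : ℕ} {Ω : Set (Space d)} (L : EllipticOperator Ω)
    (α : Fin ℓ → ℝ) (q : Fin ℓ → ℝ → ℝ) (y : ℝ → L2 Ω) (t : ℝ) (φ : Space d → ℝ) : ℝ :=
  (∫ x in Ω, (multiCaputo α q y t : L2 Ω) x * φ x) + L.pairing (y t) φ

/-- `u` solves the initial-boundary value problem
`∑ i, q_i(t) D_t^{α_i} u + 𝓛 u = f` on `Ω × (0, T]`, `u(·, 0) = u₀` on `Ω`,
`u = 0` on `∂Ω × (0, T]`. For each `t ∈ (0, T]` the equation holds in the weak sense on `Ω`. -/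
structure IsSolution {d ℓ : ℕ} {Ω : Set (Space d)} (L : EllipticOperator Ω) (T : ℝ)
    (α : Fin ℓ → ℝ) (q : Fin ℓ → ℝ → ℝ) (f : ℝ → Space d → ℝ) (u₀ : L2 Ω) (u : ℝ → L2 Ω) :
    Prop where
  initial : u 0 = u₀
  boundary : ∀ t ∈ Ioc 0 T, MemH10 Ω (u t)
  equation : ∀ t ∈ Ioc 0 T, ∀ φ : Space d → ℝ, IsTestFunction Ω φ →
    operatorPairing L α q u t φ = ∫ x in Ω, f t x * φ x

/-- The residual `R_h(·, t) = (∑ i, q_i(t) D_t^{α_i} + 𝓛) u_h(·, t) - f(·, t)`, a distribution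
on `Ω`, evaluated at the test function `φ`. -/
def residual {d ℓ : ℕ} {Ω : Set (Space d)} (L : EllipticOperator Ω)
    (α : Fin ℓ → ℝ) (q : Fin ℓ → ℝ → ℝ) (f : ℝ → Space d → ℝ) (uh : ℝ → L2 Ω)
    (t : ℝ) (φ : Space d → ℝ) : ℝ :=
  operatorPairing L α q uh t φ - ∫ x in Ω, f t x * φ x

/-- The `L_2(Ω)` norm of a distribution `S`: the norm of the unique `g ∈ L_2(Ω)` that
represents `S`, and `∞` if there is none. -/
def distribL2Norm {d : ℕ} (Ω : Set (Space d)) (S : (Space d → ℝ) → ℝ) : ℝ≥0∞ :=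
  ⨅ (g : L2 Ω) (_ : ∀ φ : Space d → ℝ, IsTestFunction Ω φ → S φ = ∫ x in Ω, g x * φ x), ‖g‖ₑ

/-- `ρ_i`, as a function of `α₁`, `α_i` and `s`, with `β = 1 - α₁`. When `α_i = α₁` the quotient
of Gamma functions is `0`, in agreement with `1 / Γ(0) = 0`. -/
def rho (α₁ αi s : ℝ) : ℝ :=
  if s < 1 then
    ordinaryHypergeometric αi (-(1 - α₁)) α₁ s
      - Real.Gamma α₁ * Real.Gamma (1 - αi) / Real.Gamma (α₁ - αi) * s ^ (1 - α₁)
  else 0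

/-- The barrier `𝓔₁(t) = (max {τ, t})^{α₁ - 1}` for `t > 0`, `𝓔₁(0) = 0`. -/
def barrier (α₁ τ t : ℝ) : ℝ :=
  if 0 < t then (max τ t) ^ (α₁ - 1) else 0

/-- `𝓡₁(t) = λ 𝓔₁(t) + τ^{-β} ∑ i, q_i(t) t^{-α_i} / Γ(1 - α_i) (1 - ρ_i(τ / t))`. -/
def residualWeight {ℓ : ℕ} [NeZero ℓ] (α : Fin ℓ → ℝ) (q : Fin ℓ → ℝ → ℝ) (lam τ t : ℝ) : ℝ :=
  lam * barrier (α 0) τ t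
    + τ ^ (-(1 - α 0)) *
      ∑ i, q i t * t ^ (-α i) / Real.Gamma (1 - α i) * (1 - rho (α 0) (α i) (τ / t))

end Subdiffusion

end

/-! The error `e = uh - u` vanishes at time zero and satisfies the equation with right-hand side the
residual. Testing with `e` itself and using coercivity gives the energy inequality `⟪∑ q_i D^{α_i}
e, e⟫ + λ‖e‖² ≤ ‖R_h‖‖e‖` (`inner_multiCaputo_error_le`).

The barrier is chosen so that `∑ q_i D^{α_i} + λ` maps it exactly to `residualWeight`
(`residualWeight_eq`). If `M` exceeds the supremum of `‖R_h‖ / residualWeight`, then `M * barrier`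
is a strict supersolution for `‖e‖`, and `norm_le_mul_barrier` compares the two. Where `M * barrier
- ‖e‖` has a negative minimum, positivity of the Caputo kernel and Cauchy–Schwarz give `⟪D^α e, e⟫ ≥
‖e‖ D^α (M * barrier)` with a strictly positive surplus (`mul_caputo_le_inner_caputo`), which
contradicts the energy inequality. Near zero the comparison is automatic because the barrier jumps
to a positive value while `e` is continuous.

The explicit part is `caputo_barrier`. It rests on `rho_eq`, which turns the hypergeometric
expression into an incomplete beta integral over `(s, 1)`. The sign of that integral yields the
bound on `rho`, hence `rho < 1` and a positive weight. -/

noncomputable section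

namespace Subdiffusion

open Filter Topology

/-! ### Weak gradients, `H^1_0`, and testing the equation with the solution itself. -/

section Elliptic

variable {d : ℕ} {Ω : Set (Space d)}

lemma continuous_gradient_of_contDiff {φ : Space d → ℝ}
    (h : ContDiff ℝ ((⊤ : ℕ∞) : WithTop ℕ∞) φ) : Continuous (gradient φ) :=
  (InnerProductSpace.toDual ℝ (Space d)).symm.continuous.comp (h.continuous_fderiv (by simp))

lemma IsTestFunction.memLp {φ : Space d → ℝ} (h : IsTestFunction Ω φ) :
    MemLp φ 2 (volume.restrict Ω) :=
  h.smooth.continuous.memLp_of_hasCompactSupport h.compactSupport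

lemma hasCompactSupport_gradient {φ : Space d → ℝ} (h : HasCompactSupport φ) :
    HasCompactSupport (gradient φ) :=
  (h.fderiv (𝕜 := ℝ)).comp_left (map_zero (InnerProductSpace.toDual ℝ (Space d)).symm)

lemma IsTestFunction.memLp_gradient {φ : Space d → ℝ} (h : IsTestFunction Ω φ) :
    MemLp (gradient φ) 2 (volume.restrict Ω) :=
  (continuous_gradient_of_contDiff h.smooth).memLp_of_hasCompactSupport
    (hasCompactSupport_gradient h.compactSupport)

lemma integrable_smul_of_memLp_two {X E : Type*} [MeasurableSpace X] {μ : Measure X}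
    [NormedAddCommGroup E] [NormedSpace ℝ E] {φ : X → ℝ} {G : X → E}
    (hφ : MemLp φ 2 μ) (hG : MemLp G 2 μ) : Integrable (fun x => φ x • G x) μ :=
  memLp_one_iff_integrable.1 (hG.smul hφ)

/-- Fundamental lemma of the calculus of variations. It is needed because `weakGradient` is an
arbitrary choice, to be exchanged freely for a known gradient. -/
lemma HasWeakGradient.ae_eq (hΩ : IsOpen Ω) {u : Space d → ℝ} {G₁ G₂ : Space d → Space d}
    (h₁ : HasWeakGradient Ω u G₁) (h₂ : HasWeakGradient Ω u G₂) :
    G₁ =ᵐ[volume.restrict Ω] G₂ := by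
  have hloc : LocallyIntegrable (fun x => G₁ x - G₂ x) (volume.restrict Ω) :=
    (h₁.2.1.sub h₂.2.1).locallyIntegrable (by norm_num)
  have key := hΩ.ae_eq_zero_of_integral_contDiff_smul_eq_zero (hloc.locallyIntegrableOn Ω)
    (fun φ hφ hc hs => by
      have hφ : IsTestFunction Ω φ := ⟨hφ, hc, hs⟩
      simp only [smul_sub]
      rw [integral_sub (integrable_smul_of_memLp_two hφ.memLp h₁.2.1)
        (integrable_smul_of_memLp_two hφ.memLp h₂.2.1), sub_eq_zero]
      have e₁ := h₁.2.2 φ hφ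
      have e₂ := h₂.2.2 φ hφ
      exact neg_injective (e₁.symm.trans e₂))
  filter_upwards [key, ae_restrict_mem hΩ.measurableSet] with x hx hxΩ
  exact sub_eq_zero.1 (hx hxΩ)

lemma HasWeakGradient.weakGradient {u : Space d → ℝ} {G : Space d → Space d}
    (h : HasWeakGradient Ω u G) : HasWeakGradient Ω u (weakGradient Ω u) := by
  have hex : ∃ G, HasWeakGradient Ω u G := ⟨G, h⟩
  rw [Subdiffusion.weakGradient, dif_pos hex]
  exact hex.choose_spec

lemma HasWeakGradient.weakGradient_ae_eq (hΩ : IsOpen Ω) {u : Space d → ℝ}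
    {G : Space d → Space d} (h : HasWeakGradient Ω u G) :
    Subdiffusion.weakGradient Ω u =ᵐ[volume.restrict Ω] G :=
  h.weakGradient.ae_eq hΩ h

lemma HasWeakGradient.sub {u v : Space d → ℝ} {G H : Space d → Space d}
    (hu : HasWeakGradient Ω u G) (hv : HasWeakGradient Ω v H) :
    HasWeakGradient Ω (fun x => u x - v x) (fun x => G x - H x) := by
  refine ⟨hu.1.sub hv.1, hu.2.1.sub hv.2.1, fun φ hφ => ?_⟩
  simp only [sub_smul, smul_sub]
  rw [integral_sub (integrable_smul_of_memLp_two hu.1 hφ.memLp_gradient)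
      (integrable_smul_of_memLp_two hv.1 hφ.memLp_gradient),
    integral_sub (integrable_smul_of_memLp_two hφ.memLp hu.2.1)
      (integrable_smul_of_memLp_two hφ.memLp hv.2.1), hu.2.2 φ hφ, hv.2.2 φ hφ]
  abel

lemma HasWeakGradient.congr {u v : Space d → ℝ} {G : Space d → Space d}
    (hu : HasWeakGradient Ω u G) (huv : u =ᵐ[volume.restrict Ω] v) : HasWeakGradient Ω v G := by
  refine ⟨hu.1.ae_eq huv, hu.2.1, fun φ hφ => ?_⟩
  rw [← hu.2.2 φ hφ]
  exact integral_congr_ae (huv.mono fun x hx => by simp only [hx])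

lemma inner_gradient_left (φ : Space d → ℝ) (x v : Space d) :
    inner ℝ (gradient φ x) v = fderiv ℝ φ x v := by
  rw [gradient, InnerProductSpace.toDual_symm_apply]

lemma IsTestFunction.hasWeakGradient {φ : Space d → ℝ} (h : IsTestFunction Ω φ) :
    HasWeakGradient Ω φ (gradient φ) := by
  refine ⟨h.memLp, h.memLp_gradient, fun ψ hψ => ?_⟩
  have hφd : Differentiable ℝ φ := h.smooth.differentiable (by simp)
  have hψd : Differentiable ℝ ψ := hψ.smooth.differentiable (by simp)
  have i₁ := integrable_smul_of_memLp_two h.memLp hψ.memLp_gradient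
  have i₂ := integrable_smul_of_memLp_two hψ.memLp h.memLp_gradient
  refine ext_inner_left ℝ fun v => ?_
  rw [inner_neg_right, ← integral_inner i₁, ← integral_inner i₂]
  have hinner : ∀ (ζ η : Space d → ℝ) (x : Space d),
      inner ℝ v (ζ x • gradient η x) = ζ x * fderiv ℝ η x v := fun ζ η x => by
    rw [inner_smul_right, real_inner_comm, inner_gradient_left]
  simp only [hinner]
  -- Both integrands vanish off `Ω`, so integration by parts takes place on the whole space and the
  -- boundary of `Ω` plays no role.
  rw [setIntegral_eq_integral_of_forall_compl_eq_zero,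
    setIntegral_eq_integral_of_forall_compl_eq_zero]
  · have cφ : Continuous fun x => fderiv ℝ φ x v :=
      (h.smooth.continuous_fderiv (by simp)).clm_apply continuous_const
    have cψ : Continuous fun x => fderiv ℝ ψ x v :=
      (hψ.smooth.continuous_fderiv (by simp)).clm_apply continuous_const
    rw [integral_mul_fderiv_eq_neg_fderiv_mul_of_integrable
      ((cφ.mul hψ.smooth.continuous).integrable_of_hasCompactSupport
        hψ.compactSupport.mul_left)
      ((h.smooth.continuous.mul cψ).integrable_of_hasCompactSupport
        h.compactSupport.mul_right)
      ((h.smooth.continuous.mul hψ.smooth.continuous).integrable_of_hasCompactSupport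
        h.compactSupport.mul_right) (fun x _ => hφd x) (fun x _ => hψd x)]
    simp only [mul_comm]
  · intro x hx
    rw [image_eq_zero_of_notMem_tsupport fun hx' => hx (hψ.support_subset hx'), zero_mul]
  · intro x hx
    rw [image_eq_zero_of_notMem_tsupport fun hx' => hx (h.support_subset hx'), zero_mul]

lemma MemH10.hasWeakGradient {u : Space d → ℝ} (h : MemH10 Ω u) :
    HasWeakGradient Ω u (weakGradient Ω u) := h.choose_spec.1.weakGradient

lemma IsTestFunction.sub {V : Type*} [NormedAddCommGroup V] [NormedSpace ℝ V] {U : Set V}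
    {φ ψ : V → ℝ} (hφ : IsTestFunction U φ) (hψ : IsTestFunction U ψ) :
    IsTestFunction U (fun x => φ x - ψ x) :=
  ⟨hφ.smooth.sub hψ.smooth, hφ.compactSupport.sub hψ.compactSupport,
    (tsupport_sub φ ψ).trans (union_subset hφ.support_subset hψ.support_subset)⟩

lemma MemH10.sub {u v : Space d → ℝ} (hu : MemH10 Ω u) (hv : MemH10 Ω v) :
    MemH10 Ω (fun x => u x - v x) := by
  obtain ⟨G, hG, hGφ⟩ := hu
  obtain ⟨H, hH, hHψ⟩ := hv
  refine ⟨_, hG.sub hH, fun ε hε => ?_⟩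
  obtain ⟨φ, hφ, h₁, h₂⟩ := hGφ (ε / 2) (ENNReal.half_pos hε.ne')
  obtain ⟨ψ, hψ, h₃, h₄⟩ := hHψ (ε / 2) (ENNReal.half_pos hε.ne')
  refine ⟨_, hφ.sub hψ, ?_, ?_⟩
  · have := eLpNorm_sub_le (hG.1.sub hφ.memLp).1 (hH.1.sub hψ.memLp).1
      (p := 2) (by norm_num)
    calc _ = eLpNorm ((u - φ) - (v - ψ)) 2 (volume.restrict Ω) := by
          congr 1; ext x; simp only [Pi.sub_apply]; ring
      _ ≤ _ := this
      _ ≤ ε / 2 + ε / 2 := add_le_add h₁ h₃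
      _ = ε := ENNReal.add_halves ε
  · have := eLpNorm_sub_le (hG.2.1.sub hφ.memLp_gradient).1 (hH.2.1.sub hψ.memLp_gradient).1
      (p := 2) (by norm_num)
    have hgrad : ∀ x, gradient (fun x => φ x - ψ x) x = gradient φ x - gradient ψ x := by
      intro x
      simp only [gradient]
      rw [fderiv_fun_sub (hφ.smooth.differentiable (by simp) x)
        (hψ.smooth.differentiable (by simp) x), map_sub]
    calc _ = eLpNorm ((G - gradient φ) - (H - gradient ψ)) 2 (volume.restrict Ω) := by
          congr 1; ext1 x; simp only [Pi.sub_apply, hgrad]; abel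
      _ ≤ _ := this
      _ ≤ ε / 2 + ε / 2 := add_le_add h₂ h₄
      _ = ε := ENNReal.add_halves ε

lemma MemH10.congr {u v : Space d → ℝ} (hu : MemH10 Ω u) (huv : u =ᵐ[volume.restrict Ω] v) :
    MemH10 Ω v := by
  obtain ⟨G, hG, hGφ⟩ := hu
  refine ⟨G, hG.congr huv, fun ε hε => ?_⟩
  obtain ⟨φ, hφ, h₁, h₂⟩ := hGφ ε hε
  exact ⟨φ, hφ, (eLpNorm_congr_ae (huv.mono fun x hx => by simp only [hx])).symm.trans_le h₁, h₂⟩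

/-- The principal flux `∑ j, a_{ij} ∂_j u + p_i u` of the operator. -/
def EllipticOperator.flux (L : EllipticOperator Ω) (u : Space d → ℝ) (G : Space d → Space d)
    (x : Space d) : Space d :=
  WithLp.toLp 2 fun i => (∑ j, L.a i j x * G x j) + L.p i x * u x

/-- The lower-order part `∑ i, b_i ∂_i u + c u` of the operator. -/
def EllipticOperator.lowerOrder (L : EllipticOperator Ω) (u : Space d → ℝ)
    (G : Space d → Space d) (x : Space d) : ℝ :=
  (∑ i, L.b i x * G x i) + L.c x * u x

lemma memLp_euclidean_apply {μ : Measure (Space d)} {p : ℝ≥0∞} {G : Space d → Space d}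
    (hG : MemLp G p μ) (i : Fin d) : MemLp (fun x => G x i) p μ :=
  (EuclideanSpace.proj (𝕜 := ℝ) i).comp_memLp' hG

lemma memLp_toLp {μ : Measure (Space d)} {p : ℝ≥0∞} {F : Space d → Fin d → ℝ}
    (hF : ∀ i, MemLp (fun x => F x i) p μ) : MemLp (fun x => WithLp.toLp 2 (F x)) p μ := by
  have h : (fun x => WithLp.toLp 2 (F x)) =
      fun x => ∑ i, F x i • EuclideanSpace.single i (1 : ℝ) := by
    ext x i
    simp [Finset.sum_apply, Pi.single_apply]
  rw [h]
  exact memLp_finsetSum _ fun i _ => by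
    exact ((ContinuousLinearMap.id ℝ ℝ).smulRight
      (EuclideanSpace.single i (1 : ℝ))).comp_memLp' (hF i)

lemma EllipticOperator.memLp_flux (L : EllipticOperator Ω) {u : Space d → ℝ}
    {G : Space d → Space d} (h : HasWeakGradient Ω u G) :
    MemLp (L.flux u G) 2 (volume.restrict Ω) :=
  memLp_toLp fun i => (memLp_finsetSum _ fun j _ =>
    (memLp_euclidean_apply h.2.1 j).mul (L.a_bdd i j)).add (h.1.mul (L.p_bdd i))

lemma EllipticOperator.memLp_lowerOrder (L : EllipticOperator Ω) {u : Space d → ℝ}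
    {G : Space d → Space d} (h : HasWeakGradient Ω u G) :
    MemLp (L.lowerOrder u G) 2 (volume.restrict Ω) :=
  (memLp_finsetSum _ fun j _ =>
    (memLp_euclidean_apply h.2.1 j).mul (L.b_bdd j)).add (h.1.mul L.c_bdd)

lemma integrable_inner_of_memLp_two {X E : Type*} [MeasurableSpace X] {μ : Measure X}
    [NormedAddCommGroup E] [InnerProductSpace ℝ E] {F G : X → E}
    (hF : MemLp F 2 μ) (hG : MemLp G 2 μ) : Integrable (fun x => inner ℝ (F x) (G x)) μ := by
  refine (L2.integrable_inner (𝕜 := ℝ) hF.toLp hG.toLp).congr ?_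
  filter_upwards [hF.coeFn_toLp, hG.coeFn_toLp] with x h₁ h₂
  rw [h₁, h₂]

lemma integral_inner_eq_inner_toLp {X E : Type*} [MeasurableSpace X] {μ : Measure X}
    [NormedAddCommGroup E] [InnerProductSpace ℝ E] {F G : X → E}
    (hF : MemLp F 2 μ) (hG : MemLp G 2 μ) :
    ∫ x, inner ℝ (F x) (G x) ∂μ = inner ℝ hF.toLp hG.toLp := by
  rw [L2.inner_def]
  refine integral_congr_ae ?_
  filter_upwards [hF.coeFn_toLp, hG.coeFn_toLp] with x h₁ h₂
  rw [h₁, h₂]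

/-- With `u` fixed, the flux and the lower-order part are fixed elements of `L_2`, so this form
exhibits the pairing as continuous in `v` for the `H^1` norm. -/
lemma EllipticOperator.pairing_eq (hΩ : IsOpen Ω) (L : EllipticOperator Ω) {u v : Space d → ℝ}
    {G H : Space d → Space d} (hu : HasWeakGradient Ω u G) (hv : HasWeakGradient Ω v H) :
    L.pairing u v = (∫ x in Ω, inner ℝ (L.flux u G x) (H x)) +
      ∫ x in Ω, inner ℝ (L.lowerOrder u G x) (v x) := by
  rw [← integral_add (integrable_inner_of_memLp_two (L.memLp_flux hu) hv.2.1)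
    (integrable_inner_of_memLp_two (L.memLp_lowerOrder hu) hv.1), EllipticOperator.pairing]
  refine integral_congr_ae ?_
  filter_upwards [hu.weakGradient_ae_eq hΩ, hv.weakGradient_ae_eq hΩ] with x h₁ h₂
  simp only [h₁, h₂, flux, lowerOrder, PiLp.inner_apply, RCLike.inner_apply, conj_trivial,
    mul_add, Finset.sum_add_distrib, Finset.mul_sum]
  simp only [← Finset.mul_sum, mul_comm, mul_left_comm]
  ring

lemma EllipticOperator.pairing_sub (hΩ : IsOpen Ω) (L : EllipticOperator Ω)
    {u v w φ : Space d → ℝ} {G H Φ : Space d → Space d} (hu : HasWeakGradient Ω u G)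
    (hv : HasWeakGradient Ω v H) (hw : w =ᵐ[volume.restrict Ω] fun x => u x - v x)
    (hφ : HasWeakGradient Ω φ Φ) :
    L.pairing w φ = L.pairing u φ - L.pairing v φ := by
  have hw' := (hu.sub hv).congr hw.symm
  rw [L.pairing_eq hΩ hu hφ, L.pairing_eq hΩ hv hφ, L.pairing_eq hΩ hw' hφ, add_sub_add_comm,
    ← integral_sub (integrable_inner_of_memLp_two (L.memLp_flux hu) hφ.2.1)
      (integrable_inner_of_memLp_two (L.memLp_flux hv) hφ.2.1),
    ← integral_sub (integrable_inner_of_memLp_two (L.memLp_lowerOrder hu) hφ.1)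
      (integrable_inner_of_memLp_two (L.memLp_lowerOrder hv) hφ.1)]
  congr 1
  · refine integral_congr_ae (hw.mono fun x hx => ?_)
    simp only
    rw [← inner_sub_left]
    congr 1
    ext i
    simp only [flux, hx, PiLp.sub_apply, mul_sub, Finset.sum_sub_distrib]
    ring
  · refine integral_congr_ae (hw.mono fun x hx => ?_)
    simp only
    rw [← inner_sub_left]
    congr 1
    simp only [lowerOrder, hx, PiLp.sub_apply, mul_sub, Finset.sum_sub_distrib]
    ring

lemma tendsto_toLp_of_eLpNorm_sub_le {X E : Type*} [MeasurableSpace X] {μ : Measure X}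
    [NormedAddCommGroup E] {F : X → E} {G : ℕ → X → E} (hF : MemLp F 2 μ)
    (hG : ∀ n, MemLp (G n) 2 μ) {ε : ℕ → ℝ≥0∞} (hε : Tendsto ε atTop (𝓝 0))
    (h : ∀ n, eLpNorm (fun x => F x - G n x) 2 μ ≤ ε n) :
    Tendsto (fun n => (hG n).toLp) atTop (𝓝 hF.toLp) := by
  rw [tendsto_iff_edist_tendsto_0]
  refine tendsto_of_tendsto_of_tendsto_of_le_of_le tendsto_const_nhds hε (fun _ => zero_le)
    fun n => ?_
  rw [edist_comm, Lp.edist_toLp_toLp]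
  exact h n

/-- A variational identity that holds for test functions may be tested with the `H^1_0` function
itself. -/
lemma EllipticOperator.inner_add_pairing_self (hΩ : IsOpen Ω) (L : EllipticOperator Ω)
    {w m g : L2 Ω} (hw : MemH10 Ω w)
    (h : ∀ φ : Space d → ℝ, IsTestFunction Ω φ →
      (∫ x in Ω, m x * φ x) + L.pairing w φ = ∫ x in Ω, g x * φ x) :
    inner ℝ m w + L.pairing w w = inner ℝ g w := by
  obtain ⟨G, hG, happ⟩ := hw
  have hε : Tendsto (fun n : ℕ => ((n : ℝ≥0∞) + 1)⁻¹) atTop (𝓝 0) := by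
    simpa using (tendsto_add_atTop_iff_nat 1).2 ENNReal.tendsto_inv_nat_nhds_zero
  choose φ hφ h₁ h₂ using fun n : ℕ => happ (((n : ℝ≥0∞) + 1)⁻¹)
    (ENNReal.inv_pos.2 (by finiteness))
  have t₁ := tendsto_toLp_of_eLpNorm_sub_le hG.1 (fun n => (hφ n).memLp) hε h₁
  have t₂ := tendsto_toLp_of_eLpNorm_sub_le hG.2.1 (fun n => (hφ n).memLp_gradient) hε h₂
  have hwl : hG.1.toLp = w := Lp.toLp_coeFn w hG.1
  rw [hwl] at t₁
  have hint : ∀ (k : L2 Ω) (n : ℕ), ∫ x in Ω, k x * φ n x = inner ℝ k ((hφ n).memLp.toLp) := by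
    intro k n
    have := integral_inner_eq_inner_toLp (Lp.memLp k) (hφ n).memLp
    rw [Lp.toLp_coeFn] at this
    rw [← this]
    simp only [RCLike.inner_apply, conj_trivial, mul_comm]
  have hpair : ∀ {v : Space d → ℝ} {H : Space d → Space d} (hv : HasWeakGradient Ω v H),
      L.pairing w v = inner ℝ (L.memLp_flux hG).toLp hv.2.1.toLp +
        inner ℝ (L.memLp_lowerOrder hG).toLp hv.1.toLp := by
    intro v H hv
    rw [L.pairing_eq hΩ hG hv, integral_inner_eq_inner_toLp (L.memLp_flux hG) hv.2.1,
      integral_inner_eq_inner_toLp (L.memLp_lowerOrder hG) hv.1]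
  have key : ∀ n, inner ℝ m (hφ n).memLp.toLp +
      (inner ℝ (L.memLp_flux hG).toLp (hφ n).memLp_gradient.toLp +
        inner ℝ (L.memLp_lowerOrder hG).toLp (hφ n).memLp.toLp) =
      inner ℝ g (hφ n).memLp.toLp := by
    intro n
    rw [← hint m, ← hint g, ← h _ (hφ n), hpair (hφ n).hasWeakGradient]
  rw [hpair hG, hwl]
  -- Both sides of `key` converge along the test functions approximating `w`, since each term is an
  -- inner product with a fixed `L_2` element.
  refine tendsto_nhds_unique ?_ (tendsto_const_nhds.inner t₁)
  simp_rw [← key]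
  exact (tendsto_const_nhds.inner t₁).add
    ((tendsto_const_nhds.inner t₂).add (tendsto_const_nhds.inner t₁))

end Elliptic

/-! ### Lipschitz regularity in time and the Caputo derivative. -/

section Time

variable {X : Type*} [NormedAddCommGroup X] [NormedSpace ℝ X]

/-- Outside `(0, 1]` the transition takes its global minimum `0` or its global maximum `1`, so its
derivative vanishes there. -/
lemma deriv_smoothTransition_eq_zero {r : ℝ} (hr : r ∉ Ioc (0 : ℝ) 1) :
    deriv Real.smoothTransition r = 0 := by
  rcases le_or_gt r 0 with h | h
  · refine IsLocalMin.deriv_eq_zero (Eventually.of_forall fun x => ?_)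
    rw [Real.smoothTransition.zero_of_nonpos h]
    exact Real.smoothTransition.nonneg x
  · have h1 : 1 ≤ r := by
      by_contra h'
      exact hr ⟨h, (not_le.1 h').le⟩
    refine IsLocalMax.deriv_eq_zero (Eventually.of_forall fun x => ?_)
    rw [Real.smoothTransition.one_of_one_le h1]
    exact Real.smoothTransition.le_one x

lemma continuous_deriv_smoothTransition : Continuous (deriv Real.smoothTransition) :=
  (Real.smoothTransition.contDiff (n := 1)).continuous_deriv le_rfl

lemma hasDerivAt_smoothTransition_comp (s δ x : ℝ) :
    HasDerivAt (fun x => Real.smoothTransition ((x - s) / δ))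
      (deriv Real.smoothTransition ((x - s) / δ) * δ⁻¹) x := by
  have h₁ : HasDerivAt (fun x => (x - s) / δ) δ⁻¹ x := by
    simpa using ((hasDerivAt_id x).sub_const s).div_const δ
  exact (((Real.smoothTransition.contDiff (n := 1)).differentiable (by simp)
    ((x - s) / δ)).hasDerivAt).comp x h₁

lemma integral_deriv_smoothTransition_smul (y : ℝ → X) {a b s δ : ℝ} (hδ : 0 < δ) (has : a ≤ s)
    (hb : s + δ < b) :
    ∫ x in Ioo a b, (deriv Real.smoothTransition ((x - s) / δ) * δ⁻¹) • y x =
      ∫ r in (0 : ℝ)..1, deriv Real.smoothTransition r • y (s + δ * r) := by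
  have h₁ : ∫ x in Ioo a b, (deriv Real.smoothTransition ((x - s) / δ) * δ⁻¹) • y x =
      ∫ x in Ioc s (s + δ), (deriv Real.smoothTransition ((x - s) / δ) * δ⁻¹) • y x := by
    refine setIntegral_eq_of_subset_of_forall_sdiff_eq_zero measurableSet_Ioo
      (fun x hx => ⟨has.trans_lt hx.1, hx.2.trans_lt hb⟩) fun x hx => ?_
    rw [deriv_smoothTransition_eq_zero, zero_mul, zero_smul]
    rintro ⟨h, h'⟩
    refine hx.2 ⟨?_, ?_⟩
    · rw [div_pos_iff_of_pos_right hδ] at h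
      linarith
    · rw [div_le_one hδ] at h'
      linarith
  have h₂ := intervalIntegral.integral_comp_add_mul (a := 0) (b := 1)
    (fun x => (deriv Real.smoothTransition ((x - s) / δ)) • y x) hδ.ne' s
  have h₃ : ∀ r : ℝ, (s + δ * r - s) / δ = r := fun r => by field_simp; ring
  simp only [h₃, mul_zero, add_zero, mul_one] at h₂
  rw [h₁, h₂, intervalIntegral.integral_of_le (by linarith), ← integral_smul]
  simp only [smul_smul, mul_comm]

/-- The derivative of the transition has total mass one on `[0, 1]`, so these are one-sided averages
of `y` shrinking to `s` from the right. -/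
lemma tendsto_integral_deriv_smoothTransition_smul [CompleteSpace X] {y : ℝ → X} {a b s : ℝ}
    (hy : ContinuousOn y (Icc a b)) (hs : s ∈ Ico a b) :
    Tendsto (fun δ => ∫ r in (0 : ℝ)..1, deriv Real.smoothTransition r • y (s + δ * r))
      (𝓝[>] 0) (𝓝 (y s)) := by
  obtain ⟨M, hM⟩ := isCompact_Icc.exists_bound_of_continuousOn hy
  have hlim : ∫ r in (0 : ℝ)..1, deriv Real.smoothTransition r • y s = y s := by
    rw [intervalIntegral.integral_smul_const, intervalIntegral.integral_deriv_eq_sub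
      (fun x _ => (Real.smoothTransition.contDiff (n := 1)).differentiable (by simp) x)
      (continuous_deriv_smoothTransition.intervalIntegrable 0 1), Real.smoothTransition.one,
      Real.smoothTransition.zero, sub_zero, one_smul]
  have hmem : ∀ {δ : ℝ}, δ ∈ Ioo 0 (b - s) → ∀ r ∈ Icc (0 : ℝ) 1, s + δ * r ∈ Icc a b := by
    intro δ hδ r hr
    have h₁ := mul_nonneg hδ.1.le hr.1
    have h₂ := mul_le_of_le_one_right hδ.1.le hr.2
    exact ⟨by linarith [hs.1], by linarith [hδ.2]⟩
  have hev : ∀ᶠ δ in 𝓝[>] (0 : ℝ), δ ∈ Ioo 0 (b - s) := Ioo_mem_nhdsGT (sub_pos.2 hs.2)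
  have key : Tendsto (fun δ => ∫ r in (0 : ℝ)..1, deriv Real.smoothTransition r • y (s + δ * r))
      (𝓝[>] 0) (𝓝 (∫ r in (0 : ℝ)..1, deriv Real.smoothTransition r • y s)) := by
    refine intervalIntegral.tendsto_integral_filter_of_dominated_convergence
      (fun r => ‖deriv Real.smoothTransition r‖ * M) ?_ ?_ ?_ ?_
    · filter_upwards [hev] with δ hδ
      rw [uIoc_of_le zero_le_one]
      refine ContinuousOn.aestronglyMeasurable ?_ measurableSet_Ioc
      refine continuous_deriv_smoothTransition.continuousOn.smul
        (hy.comp (by fun_prop) fun r hr => hmem hδ r (Ioc_subset_Icc_self hr))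
    · filter_upwards [hev] with δ hδ
      refine ae_of_all _ fun r hr => ?_
      rw [uIoc_of_le zero_le_one] at hr
      rw [norm_smul]
      exact mul_le_mul_of_nonneg_left (hM _ (hmem hδ r (Ioc_subset_Icc_self hr)))
        (norm_nonneg _)
    · exact (continuous_deriv_smoothTransition.norm.mul continuous_const).intervalIntegrable 0 1
    · refine ae_of_all _ fun r hr => ?_
      rw [uIoc_of_le zero_le_one] at hr
      refine tendsto_const_nhds.smul ((hy s ⟨hs.1, hs.2.le⟩).tendsto.comp ?_)
      refine tendsto_nhdsWithin_iff.2 ⟨?_, ?_⟩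
      · have : Continuous fun δ : ℝ => s + δ * r := by fun_prop
        simpa using (this.tendsto 0).mono_left nhdsWithin_le_nhds
      · filter_upwards [hev] with δ hδ using hmem hδ r (Ioc_subset_Icc_self hr)
  rwa [hlim] at key

/-- A smoothed indicator of `[s, t]`: it rises on `[s, s + δ]` and falls on `[t, t + δ]`. -/
lemma isTestFunction_smoothTransition_sub {a b s t δ : ℝ} (hδ : 0 < δ) (has : a < s)
    (hst : s ≤ t) (htb : t + δ < b) :
    IsTestFunction (Ioo a b) (fun x => Real.smoothTransition ((x - s) / δ) -
      Real.smoothTransition ((x - t) / δ)) := by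
  have hsupp : tsupport (fun x => Real.smoothTransition ((x - s) / δ) -
      Real.smoothTransition ((x - t) / δ)) ⊆ Icc s (t + δ) := by
    refine closure_minimal (fun x hx => ?_) isClosed_Icc
    by_contra h
    refine hx ?_
    rcases lt_or_ge x s with h₁ | h₁
    · simp only
      rw [Real.smoothTransition.zero_of_nonpos (div_nonpos_of_nonpos_of_nonneg
        (by linarith) hδ.le), Real.smoothTransition.zero_of_nonpos
        (div_nonpos_of_nonpos_of_nonneg (by linarith) hδ.le), sub_zero]
    · have h₂ : t + δ < x := by
        by_contra h'
        exact h ⟨h₁, not_lt.1 h'⟩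
      simp only
      rw [Real.smoothTransition.one_of_one_le ((one_le_div hδ).2 (by linarith)),
        Real.smoothTransition.one_of_one_le ((one_le_div hδ).2 (by linarith)), sub_self]
  refine ⟨?_, HasCompactSupport.of_support_subset_isCompact isCompact_Icc
    (subset_closure.trans hsupp), hsupp.trans fun x hx =>
      ⟨has.trans_le hx.1, hx.2.trans_lt htb⟩⟩
  exact (Real.smoothTransition.contDiff.comp (by fun_prop)).sub
    (Real.smoothTransition.contDiff.comp (by fun_prop))

/-- A continuous function in `W^{1,∞}(a, b; X)` is Lipschitz on `(a, b)`. -/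
lemma MemW1Infty.exists_norm_sub_le [CompleteSpace X] {y : ℝ → X} {a b : ℝ}
    (hy : ContinuousOn y (Icc a b)) (h : MemW1Infty a b y) :
    ∃ C : ℝ, 0 ≤ C ∧ ∀ s ∈ Ioo a b, ∀ t ∈ Ioo a b, s ≤ t → ‖y t - y s‖ ≤ C * (t - s) := by
  obtain ⟨-, y', hy', hweak⟩ := h
  refine ⟨(eLpNormEssSup y' (volume.restrict (Ioo a b))).toReal, ENNReal.toReal_nonneg,
    fun s hs t ht hst => ?_⟩
  set C := (eLpNormEssSup y' (volume.restrict (Ioo a b))).toReal with hC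
  have hfin : eLpNormEssSup y' (volume.restrict (Ioo a b)) ≠ ∞ := by
    simpa [eLpNorm_exponent_top] using hy'.2.ne
  have hbound : ∀ᵐ x ∂volume.restrict (Ioo a b), ‖y' x‖ ≤ C := by
    filter_upwards [enorm_ae_le_eLpNormEssSup y' (volume.restrict (Ioo a b))] with x hx
    rw [hC, ← toReal_enorm]
    exact ENNReal.toReal_mono hfin hx
  have hev : ∀ᶠ δ in 𝓝[>] (0 : ℝ), δ ∈ Ioo 0 (b - t) := Ioo_mem_nhdsGT (sub_pos.2 ht.2)
  have t₁ := tendsto_integral_deriv_smoothTransition_smul hy (s := s) ⟨hs.1.le, hs.2⟩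
  have t₂ := tendsto_integral_deriv_smoothTransition_smul hy (s := t) ⟨ht.1.le, ht.2⟩
  have t₃ : Tendsto (fun δ : ℝ => C * (t + δ - s)) (𝓝[>] 0) (𝓝 (C * (t - s))) := by
    have : Continuous fun δ : ℝ => C * (t + δ - s) := by fun_prop
    simpa using (this.tendsto 0).mono_left nhdsWithin_le_nhds
  refine le_of_tendsto_of_tendsto (t₂.sub t₁).norm t₃ ?_
  filter_upwards [hev] with δ hδ
  have hδb : t + δ < b := by linarith [hδ.2]
  have hφ := isTestFunction_smoothTransition_sub hδ.1 hs.1 hst hδb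
  have hint : ∀ r, Integrable (fun x => (deriv Real.smoothTransition ((x - r) / δ) * δ⁻¹) • y x)
      (volume.restrict (Ioo a b)) := fun r => by
    refine IntegrableOn.mono_set (ContinuousOn.integrableOn_Icc ?_) Ioo_subset_Icc_self
    exact ((continuous_deriv_smoothTransition.comp (by fun_prop)).mul
      continuous_const).continuousOn.smul hy
  -- Against the smoothed indicator, the left side is a difference of averages tending to `y s - y
  -- t`, and the right side is at most `C` times the length `t + δ - s` of an interval carrying the
  -- indicator.
  have hw := hweak _ hφ
  have hd : ∀ x, deriv (fun x => Real.smoothTransition ((x - s) / δ) -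
      Real.smoothTransition ((x - t) / δ)) x =
      deriv Real.smoothTransition ((x - s) / δ) * δ⁻¹ -
        deriv Real.smoothTransition ((x - t) / δ) * δ⁻¹ := fun x =>
    ((hasDerivAt_smoothTransition_comp s δ x).sub
      (hasDerivAt_smoothTransition_comp t δ x)).deriv
  simp only [hd, sub_smul] at hw
  rw [integral_sub (hint s) (hint t), integral_deriv_smoothTransition_smul y hδ.1 hs.1.le
    (by linarith), integral_deriv_smoothTransition_smul y hδ.1 ht.1.le hδb] at hw
  rw [norm_sub_rev, hw, norm_neg]
  have hrestr : ∫ x in Ioo a b, Real.smoothTransition ((x - s) / δ) • y' x -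
        Real.smoothTransition ((x - t) / δ) • y' x =
      ∫ x in Icc s (t + δ), (Real.smoothTransition ((x - s) / δ) -
        Real.smoothTransition ((x - t) / δ)) • y' x := by
    simp only [← sub_smul]
    refine setIntegral_eq_of_subset_of_forall_sdiff_eq_zero measurableSet_Ioo
      (fun x hx => ⟨hs.1.trans_le hx.1, hx.2.trans_lt hδb⟩) fun x hx => ?_
    rcases lt_or_ge x s with h₁ | h₁
    · rw [Real.smoothTransition.zero_of_nonpos (div_nonpos_of_nonpos_of_nonneg
        (by linarith) hδ.1.le), Real.smoothTransition.zero_of_nonpos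
        (div_nonpos_of_nonpos_of_nonneg (by linarith) hδ.1.le), sub_zero, zero_smul]
    · have h₂ : t + δ < x := by
        by_contra h'
        exact hx.2 ⟨h₁, not_lt.1 h'⟩
      rw [Real.smoothTransition.one_of_one_le ((one_le_div hδ.1).2 (by linarith)),
        Real.smoothTransition.one_of_one_le ((one_le_div hδ.1).2 (by linarith)), sub_self,
        zero_smul]
  rw [hrestr]
  have hvol : volume.real (Icc s (t + δ)) = t + δ - s := by
    rw [Real.volume_real_Icc_of_le (by linarith [hδ.1])]
  rw [← hvol]
  refine norm_setIntegral_le_of_norm_le_const_ae (by simp) ?_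
  have hsub : Icc s (t + δ) ⊆ Ioo a b := fun x hx => ⟨hs.1.trans_le hx.1, hx.2.trans_lt hδb⟩
  have hbound' := ae_restrict_of_ae_restrict_of_subset hsub hbound
  filter_upwards [hbound'] with x hx
  rw [norm_smul]
  refine (mul_le_of_le_one_left (norm_nonneg _) ?_).trans hx
  rw [Real.norm_eq_abs, abs_le]
  constructor <;> linarith [Real.smoothTransition.nonneg ((x - s) / δ),
    Real.smoothTransition.nonneg ((x - t) / δ), Real.smoothTransition.le_one ((x - s) / δ),
    Real.smoothTransition.le_one ((x - t) / δ)]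

/-- Near `t` the `W^{1,∞}` bound on `(t/4, T)` applies. For `s < t / 2` boundedness of `y` suffices,
because `t - s ≥ t / 2`; this produces the term `2 * M / (t / 2)`. -/
lemma TimeRegular.exists_norm_sub_le [CompleteSpace X] {T : ℝ} {y : ℝ → X}
    (h : TimeRegular T y) {t : ℝ} (ht : t ∈ Ioc 0 T) :
    ∃ C : ℝ, ∀ s ∈ Icc 0 t, ‖y t - y s‖ ≤ C * (t - s) := by
  have ht2 : 0 < t / 2 := half_pos ht.1
  have hsub : Icc (t / 4) T ⊆ Icc 0 T := Icc_subset_Icc_left (by linarith)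
  obtain ⟨C, hC0, hC⟩ := (h.2 (t / 4) ⟨by linarith, by linarith [ht.2]⟩).exists_norm_sub_le
    (h.1.mono hsub)
  obtain ⟨M, hM⟩ := isCompact_Icc.exists_bound_of_continuousOn h.1
  have hM0 : 0 ≤ M := (norm_nonneg _).trans (hM t ⟨ht.1.le, ht.2⟩)
  have hlip : ∀ s ∈ Ico (t / 2) t, ‖y t - y s‖ ≤ C * (t - s) := by
    intro s hs
    have c₁ : ContinuousWithinAt (fun r => ‖y r - y s‖) (Ioo s t) t :=
      (((h.1 t ⟨ht.1.le, ht.2⟩).mono fun r hr =>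
        ⟨by linarith [hr.1, hs.1], by linarith [hr.2, ht.2]⟩).sub
          continuousWithinAt_const).norm
    have c₂ : ContinuousWithinAt (fun r => C * (r - s)) (Ioo s t) t := by fun_prop
    -- The Lipschitz bound is known only in the open interval and `t` may equal `T`, so it is
    -- carried to `t` by continuity from the left.
    refine ContinuousWithinAt.closure_le ?_ c₁ c₂ fun r hr => ?_
    · rw [closure_Ioo hs.2.ne]
      exact right_mem_Icc.2 hs.2.le
    · exact hC s ⟨by linarith [hs.1], by linarith [hs.2, ht.2]⟩ r
        ⟨by linarith [hr.1, hs.1], by linarith [hr.2, ht.2]⟩ hr.1.le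
  refine ⟨C + 2 * M / (t / 2), fun s hs => ?_⟩
  rcases hs.2.eq_or_lt with rfl | hst
  · simp
  have hts : 0 ≤ t - s := by linarith
  rw [add_mul]
  rcases lt_or_ge s (t / 2) with hs2 | hs2
  · have h₁ : ‖y t - y s‖ ≤ 2 * M := by
      linarith [norm_sub_le (y t) (y s), hM t ⟨ht.1.le, ht.2⟩, hM s ⟨hs.1, hs.2.trans ht.2⟩]
    have h₂ : 2 * M ≤ 2 * M / (t / 2) * (t - s) := by
      rw [div_mul_eq_mul_div, le_div_iff₀ ht2]
      exact mul_le_mul_of_nonneg_left (by linarith) (by linarith)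
    linarith [mul_nonneg hC0 hts]
  · have := hlip s ⟨hs2, hst⟩
    have h₂ : 0 ≤ 2 * M / (t / 2) * (t - s) := by positivity
    linarith

lemma intervalIntegrable_sub_rpow {t r : ℝ} (hr : -1 < r) :
    IntervalIntegrable (fun s => (t - s) ^ r) volume 0 t := by
  have := (intervalIntegral.intervalIntegrable_rpow' hr (a := 0) (b := t)).comp_sub_left t
  simpa using this.symm

/-- The Lipschitz factor absorbs one power of the singularity and leaves `(t - s) ^ (-α)`,
integrable because `α < 1`. -/
lemma intervalIntegrable_caputo {α : ℝ} (hα1 : α < 1) {t : ℝ} (ht : 0 < t) {y : ℝ → X}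
    (hy : ContinuousOn y (Ioo 0 t)) {C : ℝ} (hC : ∀ s ∈ Ioo 0 t, ‖y t - y s‖ ≤ C * (t - s)) :
    IntervalIntegrable (fun s => (α * (t - s) ^ (-α - 1)) • (y t - y s)) volume 0 t := by
  have hdom : IntervalIntegrable (fun s => |α| * C * (t - s) ^ (-α)) volume 0 t :=
    (intervalIntegrable_sub_rpow (by linarith)).const_mul _
  rw [intervalIntegrable_iff_integrableOn_Ioo_of_le ht.le] at hdom ⊢
  refine hdom.mono' ?_ ?_
  · refine ContinuousOn.aestronglyMeasurable ?_ measurableSet_Ioo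
    refine ContinuousOn.smul ?_ (continuousOn_const.sub hy)
    refine continuousOn_const.mul (ContinuousOn.rpow_const (by fun_prop) fun s hs => ?_)
    exact Or.inl (sub_pos.2 hs.2).ne'
  · refine (ae_restrict_iff' measurableSet_Ioo).2 (ae_of_all _ fun s hs => ?_)
    have hts : 0 < t - s := sub_pos.2 hs.2
    rw [norm_smul, norm_mul, Real.norm_eq_abs, Real.norm_eq_abs,
      abs_of_nonneg (Real.rpow_nonneg hts.le _)]
    calc |α| * (t - s) ^ (-α - 1) * ‖y t - y s‖
        ≤ |α| * (t - s) ^ (-α - 1) * (C * (t - s)) :=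
          mul_le_mul_of_nonneg_left (hC s hs) (by positivity)
      _ = |α| * C * (t - s) ^ (-α) := by
          rw [Real.rpow_sub_one hts.ne']
          field_simp

lemma TimeRegular.intervalIntegrable_caputo [CompleteSpace X] {T : ℝ} {y : ℝ → X}
    (h : TimeRegular T y) {t : ℝ} (ht : t ∈ Ioc 0 T) {α : ℝ} (hα1 : α < 1) :
    IntervalIntegrable (fun s => (α * (t - s) ^ (-α - 1)) • (y t - y s)) volume 0 t := by
  obtain ⟨C, hC⟩ := h.exists_norm_sub_le ht
  exact Subdiffusion.intervalIntegrable_caputo hα1 ht.1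
    (h.1.mono fun s hs => ⟨hs.1.le, hs.2.le.trans ht.2⟩)
    fun s hs => hC s ⟨hs.1.le, hs.2.le⟩

lemma caputo_sub {α t : ℝ} {y z : ℝ → X}
    (hy : IntervalIntegrable (fun s => (α * (t - s) ^ (-α - 1)) • (y t - y s)) volume 0 t)
    (hz : IntervalIntegrable (fun s => (α * (t - s) ^ (-α - 1)) • (z t - z s)) volume 0 t) :
    caputo α (fun s => y s - z s) t = caputo α y t - caputo α z t := by
  unfold caputo
  rw [← smul_sub, add_sub_add_comm, ← smul_sub, ← intervalIntegral.integral_sub hy hz]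
  simp only [← smul_sub, sub_sub_sub_comm]

/-- Comparison of the Caputo derivative of a Hilbert space valued function with that of a scalar
majorant touching its norm from above, up to a constant, at time `t`. -/
lemma mul_caputo_le_inner_caputo {H : Type*} [NormedAddCommGroup H] [InnerProductSpace ℝ H]
    [CompleteSpace H] {α t : ℝ} (hα : 0 < α) (hα1 : α < 1) (ht : 0 < t) {e : ℝ → H}
    {b : ℝ → ℝ} (he : IntervalIntegrable
      (fun s => (α * (t - s) ^ (-α - 1)) • (e t - e s)) volume 0 t)
    (hb : IntervalIntegrable (fun s => (α * (t - s) ^ (-α - 1)) • (b t - b s)) volume 0 t)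
    (he0 : e 0 = 0) (hb0 : b 0 = 0) (hmin : ∀ s ∈ Ioo 0 t, b t - b s ≤ ‖e t‖ - ‖e s‖) :
    ‖e t‖ * (caputo α b t + (Real.Gamma (1 - α))⁻¹ * t ^ (-α) * (‖e t‖ - b t)) ≤
      inner ℝ (caputo α e t) (e t) := by
  have hΓ : 0 < (Real.Gamma (1 - α))⁻¹ := inv_pos.2 (Real.Gamma_pos_of_pos (by linarith))
  unfold caputo
  rw [he0, hb0, sub_zero, sub_zero, real_inner_smul_left, inner_add_left, real_inner_smul_left,
    real_inner_self_eq_norm_sq, smul_eq_mul, smul_eq_mul]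
  have hI : ‖e t‖ * ∫ s in (0 : ℝ)..t, (α * (t - s) ^ (-α - 1)) • (b t - b s) ≤
      inner ℝ (∫ s in (0 : ℝ)..t, (α * (t - s) ^ (-α - 1)) • (e t - e s)) (e t) := by
    have hcomm : inner ℝ (∫ s in (0 : ℝ)..t, (α * (t - s) ^ (-α - 1)) • (e t - e s)) (e t) =
        ∫ s in (0 : ℝ)..t, inner ℝ (e t) ((α * (t - s) ^ (-α - 1)) • (e t - e s)) := by
      rw [real_inner_comm]
      exact ((innerSL ℝ (e t)).intervalIntegral_comp_comm he).symm
    rw [hcomm, ← intervalIntegral.integral_const_mul]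
    refine intervalIntegral.integral_mono_on_of_le_Ioo ht.le (hb.const_mul _) ?_ fun s hs => ?_
    · rw [intervalIntegrable_iff] at he ⊢
      exact he.const_inner (e t)
    · have hts : 0 < t - s := sub_pos.2 hs.2
      have hk : 0 ≤ α * (t - s) ^ (-α - 1) := by positivity
      rw [real_inner_smul_right, smul_eq_mul, inner_sub_right, real_inner_self_eq_norm_sq,
        mul_left_comm]
      refine mul_le_mul_of_nonneg_left ?_ hk
      -- Cauchy–Schwarz gives `⟪e t, e t - e s⟫ ≥ ‖e t‖ (‖e t‖ - ‖e s‖)`, and `hmin` bounds this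
      -- below by `‖e t‖ (b t - b s)`.
      have := mul_le_mul_of_nonneg_left (hmin s hs) (norm_nonneg (e t))
      have := real_inner_le_norm (e t) (e s)
      nlinarith
  -- Replacing `b t` by `‖e t‖` in the boundary term `t ^ (-α) * b t` is what creates the surplus on
  -- the left.
  calc _ = (Real.Gamma (1 - α))⁻¹ * (t ^ (-α) * ‖e t‖ ^ 2 +
      ‖e t‖ * ∫ s in (0 : ℝ)..t, (α * (t - s) ^ (-α - 1)) • (b t - b s)) := by ring
    _ ≤ _ := mul_le_mul_of_nonneg_left (add_le_add_right hI _) hΓ.le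

end Time

/-! ### The function `rho` as an incomplete beta integral. -/

section Hypergeometric

lemma ascPochhammer_eval_nonneg {a : ℝ} (ha : 0 ≤ a) (n : ℕ) :
    0 ≤ (ascPochhammer ℝ n).eval a := by
  induction n with
  | zero => simp
  | succ n ih => rw [ascPochhammer_succ_eval]; positivity

lemma hasSum_ascPochhammer_mul_pow (a : ℝ) {x : ℝ} (hx : |x| < 1) :
    HasSum (fun n : ℕ => ((n.factorial : ℝ)⁻¹ * (ascPochhammer ℝ n).eval a) * x ^ n)
      ((1 - x) ^ (-a)) := by
  have h := (Real.one_div_one_sub_rpow_hasFPowerSeriesOnBall_zero a).hasSum (y := x)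
    (by simpa [enorm_eq_nnnorm, ← NNReal.coe_lt_coe] using hx)
  have h1 : 0 ≤ 1 - x := by linarith [(abs_lt.1 hx).2]
  rw [zero_add, one_div, ← Real.rpow_neg h1] at h
  refine h.congr_fun fun n => ?_
  have hf := Ring.factorial_nsmul_multichoose_eq_ascPochhammer a n
  have hn : (n.factorial : ℝ) ≠ 0 := by positivity
  rw [Polynomial.ascPochhammer_smeval_eq_eval, nsmul_eq_mul] at hf
  rw [FormalMultilinearSeries.ofScalars_apply_eq, smul_eq_mul, ← Ring.multichoose_eq, ← hf,
    inv_mul_cancel_left₀ hn]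

/-- The quotient telescopes to a simple fraction in `n`, which makes the hypergeometric series an
integrated binomial series. -/
lemma ascPochhammer_sub_one_div {c : ℝ} (hc : 0 < c) (hc1 : c < 1) (n : ℕ) :
    (ascPochhammer ℝ n).eval (c - 1) * ((ascPochhammer ℝ n).eval c)⁻¹ =
      (c - 1) / (c - 1 + n) := by
  have h₁ : (ascPochhammer ℝ (n + 1)).eval (c - 1) =
      (ascPochhammer ℝ n).eval (c - 1) * (c - 1 + n) := ascPochhammer_succ_eval n (c - 1)
  have h₂ : (ascPochhammer ℝ (n + 1)).eval (c - 1) = (c - 1) * (ascPochhammer ℝ n).eval c := by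
    rw [ascPochhammer_succ_left]
    simp [Polynomial.eval_comp]
  have h₃ : 0 < (ascPochhammer ℝ n).eval c := ascPochhammer_pos n c hc
  have h₄ : c - 1 + n ≠ 0 := by
    rcases Nat.eq_zero_or_pos n with rfl | hn
    · simp; linarith
    · have : (1 : ℝ) ≤ n := by exact_mod_cast hn
      linarith
  rw [← div_eq_mul_inv, div_eq_div_iff h₃.ne' h₄, ← h₁, h₂]

lemma hasSum_integral_rpow_mul_one_sub_rpow {a c s : ℝ} (ha : 0 < a) (hc : 0 < c) (hs0 : 0 < s)
    (hs1 : s < 1) :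
    HasSum (fun n : ℕ => ((n.factorial : ℝ)⁻¹ * (ascPochhammer ℝ n).eval a) *
      (s ^ (n + c) / (n + c))) (∫ x in (0 : ℝ)..s, x ^ (c - 1) * (1 - x) ^ (-a)) := by
  have hint : ∀ n : ℕ, ∫ x in (0 : ℝ)..s, ((n.factorial : ℝ)⁻¹ * (ascPochhammer ℝ n).eval a) *
      (x ^ n * x ^ (c - 1)) = ((n.factorial : ℝ)⁻¹ * (ascPochhammer ℝ n).eval a) *
      (s ^ (n + c) / (n + c)) := by
    intro n
    have hnc : (n : ℝ) + c ≠ 0 := by positivity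
    rw [intervalIntegral.integral_const_mul]
    congr 1
    have : ∫ x in (0 : ℝ)..s, x ^ n * x ^ (c - 1) = ∫ x in (0 : ℝ)..s, x ^ (n + c - 1) := by
      refine intervalIntegral.integral_congr_ae (ae_of_all _ fun x hx => ?_)
      rw [uIoc_of_le hs0.le] at hx
      rw [← Real.rpow_natCast, ← Real.rpow_add hx.1, add_sub_assoc]
    rw [this, integral_rpow (Or.inl (by linarith [(Nat.cast_nonneg n : (0 : ℝ) ≤ n)]))]
    rw [sub_add_cancel, Real.zero_rpow hnc, sub_zero]
  simp only [← hint]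
  have hsum : ∀ x ∈ Ioc 0 s, HasSum (fun n : ℕ =>
      ((n.factorial : ℝ)⁻¹ * (ascPochhammer ℝ n).eval a) * (x ^ n * x ^ (c - 1)))
      (x ^ (c - 1) * (1 - x) ^ (-a)) := by
    intro x hx
    have := (hasSum_ascPochhammer_mul_pow a (x := x)
      (abs_lt.2 ⟨by linarith [hx.1], hx.2.trans_lt hs1⟩)).mul_left (x ^ (c - 1))
    refine this.congr_fun fun n => ?_
    ring
  have hinteg : IntervalIntegrable (fun x => x ^ (c - 1) * (1 - x) ^ (-a)) volume 0 s := by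
    refine (intervalIntegral.intervalIntegrable_rpow' (by linarith)).mul_continuousOn ?_
    refine ContinuousOn.rpow_const (by fun_prop) fun x hx => ?_
    rw [uIcc_of_le hs0.le] at hx
    exact Or.inl (by linarith [hx.2])
  -- All terms are nonnegative, so the series serves as its own dominating function, with sum the
  -- integrable function of `hinteg`.
  refine intervalIntegral.hasSum_integral_of_dominated_convergence
    (fun n x => ((n.factorial : ℝ)⁻¹ * (ascPochhammer ℝ n).eval a) * (x ^ n * x ^ (c - 1)))
    (fun n => ?_) (fun n => ae_of_all _ fun x hx => ?_) (ae_of_all _ fun x hx => ?_) ?_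
    (ae_of_all _ fun x hx => ?_)
  · exact (by fun_prop : Measurable _).aestronglyMeasurable
  · rw [uIoc_of_le hs0.le] at hx
    refine (Real.norm_of_nonneg ?_).le
    have := ascPochhammer_eval_nonneg ha.le n
    have := hx.1
    positivity
  · rw [uIoc_of_le hs0.le] at hx
    exact (hsum x hx).summable
  · refine hinteg.congr fun x hx => ?_
    rw [uIoc_of_le hs0.le] at hx
    exact (hsum x hx).tsum_eq.symm
  · rw [uIoc_of_le hs0.le] at hx
    exact hsum x hx

lemma ordinaryHypergeometric_eq_add_integral {a c s : ℝ} (ha : 0 < a) (hc : 0 < c) (hc1 : c < 1)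
    (hs0 : 0 < s) (hs1 : s < 1) :
    ordinaryHypergeometric a (c - 1) c s =
      (1 - s) ^ (1 - a) +
        (c - a) * s ^ (1 - c) * ∫ x in (0 : ℝ)..s, x ^ (c - 1) * (1 - x) ^ (-a) := by
  have h₁ := hasSum_ascPochhammer_mul_pow (a - 1) (x := s) (abs_lt.2 ⟨by linarith, hs1⟩)
  have h₂ := (hasSum_integral_rpow_mul_one_sub_rpow ha hc hs0 hs1).mul_left
    ((c - a) * s ^ (1 - c))
  rw [neg_sub] at h₁
  -- The factor `s ^ (1 - c)` turns `s ^ (m + c)` into `s ^ (m + 1)`, so the integral contributes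
  -- from degree one on. `D` is its series shifted by one, ready for comparison of coefficients.
  set D : ℕ → ℝ := fun n => Nat.rec 0 (fun m _ => (c - a) * s ^ (1 - c) *
    (((m.factorial : ℝ)⁻¹ * (ascPochhammer ℝ m).eval a) * (s ^ (m + c) / (m + c)))) n with hD
  have h₃ : HasSum D ((c - a) * s ^ (1 - c) * ∫ x in (0 : ℝ)..s, x ^ (c - 1) * (1 - x) ^ (-a)) := by
    have := (hasSum_nat_add_iff (f := D) 1).1 h₂
    simpa [hD] using this
  rw [ordinaryHypergeometric_eq_tsum, ← (h₁.add h₃).tsum_eq]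
  refine tsum_congr fun n => ?_
  rw [smul_eq_mul, mul_assoc _ ((ascPochhammer ℝ n).eval (c - 1)),
    ascPochhammer_sub_one_div hc hc1]
  cases n with
  | zero =>
    have : c - 1 ≠ 0 := by linarith
    simp [hD, this]
  | succ m =>
    have hm : (0 : ℝ) ≤ m := Nat.cast_nonneg m
    have e₁ : (ascPochhammer ℝ (m + 1)).eval a = (ascPochhammer ℝ m).eval a * (a + m) :=
      ascPochhammer_succ_eval m a
    have e₂ : (ascPochhammer ℝ (m + 1)).eval (a - 1) = (a - 1) * (ascPochhammer ℝ m).eval a := by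
      rw [ascPochhammer_succ_left]
      simp [Polynomial.eval_comp]
    have e₃ : s ^ (1 - c) * s ^ ((m : ℝ) + c) = s ^ (m + 1) := by
      rw [← Real.rpow_add hs0, ← Real.rpow_natCast]
      congr 1
      push_cast
      ring
    have e₄ : D (m + 1) = (c - a) * (((m.factorial : ℝ)⁻¹ * (ascPochhammer ℝ m).eval a) *
        (s ^ (m + 1) / (m + c))) := by
      rw [← e₃]
      simp only [hD]
      ring
    have hmc : (m : ℝ) + c ≠ 0 := by positivity
    have hf : (m.factorial : ℝ) ≠ 0 := by positivity
    rw [e₄, e₁, e₂, Nat.factorial_succ]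
    have hmc' : c - 1 + ((m + 1 : ℕ) : ℝ) = m + c := by push_cast; ring
    rw [hmc']
    push_cast
    field_simp
    ring

lemma intervalIntegrable_rpow_mul_one_sub_rpow {a c : ℝ} (ha1 : a < 1) (hc : 0 < c) :
    IntervalIntegrable (fun x : ℝ => x ^ (c - 1) * (1 - x) ^ (-a)) volume 0 1 := by
  have h₁ : IntervalIntegrable (fun x : ℝ => x ^ (c - 1) * (1 - x) ^ (-a)) volume 0 (1 / 2) := by
    refine (intervalIntegral.intervalIntegrable_rpow' (by linarith)).mul_continuousOn ?_
    refine ContinuousOn.rpow_const (by fun_prop) fun x hx => ?_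
    rw [uIcc_of_le (by norm_num)] at hx
    exact Or.inl (by linarith [hx.2])
  have h₂ : IntervalIntegrable (fun x : ℝ => x ^ (c - 1) * (1 - x) ^ (-a)) volume (1 / 2) 1 := by
    refine IntervalIntegrable.continuousOn_mul ?_ ?_
    · exact (intervalIntegrable_sub_rpow (t := 1) (by linarith)).mono_set
        (by rw [uIcc_of_le (by norm_num), uIcc_of_le (by norm_num)]
            exact Icc_subset_Icc_left (by norm_num))
    · refine ContinuousOn.rpow_const (by fun_prop) fun x hx => ?_
      rw [uIcc_of_le (by norm_num)] at hx
      exact Or.inl (by linarith [hx.1])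
  exact h₁.trans h₂

lemma integral_rpow_mul_one_sub_rpow {a c : ℝ} (ha1 : a < 1) (hc : 0 < c) :
    ∫ x in (0 : ℝ)..1, x ^ (c - 1) * (1 - x) ^ (-a) =
      Real.Gamma c * Real.Gamma (1 - a) / Real.Gamma (c + (1 - a)) := by
  have h := Complex.betaIntegral_eq_Gamma_mul_div (c : ℂ) ((1 - a : ℝ) : ℂ) (by simpa using hc)
    (by rw [Complex.ofReal_re]; linarith)
  rw [← Complex.ofReal_add, Complex.Gamma_ofReal, Complex.Gamma_ofReal, Complex.Gamma_ofReal,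
    Complex.betaIntegral] at h
  have hcast : ∫ x in (0 : ℝ)..1, (x : ℂ) ^ ((c : ℂ) - 1) * (1 - (x : ℂ)) ^ (((1 - a : ℝ) : ℂ) - 1)
      = ((∫ x in (0 : ℝ)..1, x ^ (c - 1) * (1 - x) ^ (-a) : ℝ) : ℂ) := by
    rw [← intervalIntegral.integral_ofReal]
    refine intervalIntegral.integral_congr fun x hx => ?_
    rw [uIcc_of_le zero_le_one] at hx
    have h1x : 0 ≤ 1 - x := by linarith [hx.2]
    rw [Complex.ofReal_mul, Complex.ofReal_cpow hx.1, Complex.ofReal_cpow h1x]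
    push_cast
    congr 2
    ring
  rw [hcast] at h
  exact_mod_cast h

lemma Gamma_mul_Gamma_div_Gamma_sub {a c : ℝ} (ha1 : a < 1) (hc : 0 < c) :
    Real.Gamma c * Real.Gamma (1 - a) / Real.Gamma (c - a) =
      (c - a) * ∫ x in (0 : ℝ)..1, x ^ (c - 1) * (1 - x) ^ (-a) := by
  rw [integral_rpow_mul_one_sub_rpow ha1 hc]
  -- For `c = a` the left side is a division by `Gamma 0 = 0`, hence `0`, in agreement with the
  -- factor `c - a`.
  rcases eq_or_ne (c - a) 0 with h | h
  · simp [h]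
  · rw [show c + (1 - a) = (c - a) + 1 by ring, Real.Gamma_add_one h, ← mul_div_assoc,
      mul_div_mul_left _ _ h]

/-- The Gamma quotient is the complete beta integral over `(0, 1)`; subtracting it from the integral
over `(0, s)` leaves minus the tail over `(s, 1)`, which has a definite sign when `a ≤ c`. -/
lemma rho_eq {a c s : ℝ} (ha : 0 < a) (ha1 : a < 1) (hc : 0 < c) (hc1 : c < 1) (hs0 : 0 < s)
    (hs1 : s < 1) :
    rho c a s = (1 - s) ^ (1 - a) -
      (c - a) * s ^ (1 - c) * ∫ x in s..1, x ^ (c - 1) * (1 - x) ^ (-a) := by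
  have hi := intervalIntegrable_rpow_mul_one_sub_rpow ha1 hc
  have h₁ := intervalIntegral.integral_add_adjacent_intervals
    (hi.mono_set (c := 0) (d := s) (by
      rw [uIcc_of_le hs0.le, uIcc_of_le zero_le_one]; exact Icc_subset_Icc_right hs1.le))
    (hi.mono_set (c := s) (d := 1) (by
      rw [uIcc_of_le hs1.le, uIcc_of_le zero_le_one]; exact Icc_subset_Icc_left hs0.le))
  rw [rho, if_pos hs1, neg_sub, ordinaryHypergeometric_eq_add_integral ha hc hc1 hs0 hs1,
    Gamma_mul_Gamma_div_Gamma_sub ha1 hc, ← h₁]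
  ring

lemma rho_le {a c s : ℝ} (ha : 0 < a) (hac : a ≤ c) (hc1 : c < 1) (hs0 : 0 < s)
    (hs1 : s < 1) : rho c a s ≤ (1 - s) ^ (1 - a) := by
  rw [rho_eq ha (by linarith) (by linarith) hc1 hs0 hs1]
  have : 0 ≤ ∫ x in s..1, x ^ (c - 1) * (1 - x) ^ (-a) :=
    intervalIntegral.integral_nonneg hs1.le fun x hx =>
      mul_nonneg (Real.rpow_nonneg (by linarith [hx.1]) _)
        (Real.rpow_nonneg (by linarith [hx.2]) _)
  have h2 : 0 ≤ c - a := by linarith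
  have : 0 ≤ (c - a) * s ^ (1 - c) * ∫ x in s..1, x ^ (c - 1) * (1 - x) ^ (-a) := by positivity
  linarith

lemma one_sub_rpow_lt_one {a s : ℝ} (ha1 : a < 1) (hs0 : 0 < s) (hs1 : s < 1) :
    (1 - s) ^ (1 - a) < 1 :=
  Real.rpow_lt_one (by linarith) (by linarith) (by linarith)

lemma rho_lt_one {a c s : ℝ} (ha : 0 < a) (hac : a ≤ c) (hc1 : c < 1) (hs0 : 0 < s) :
    rho c a s < 1 := by
  rcases lt_or_ge s 1 with hs1 | hs1
  · exact (rho_le ha hac hc1 hs0 hs1).trans_lt (one_sub_rpow_lt_one (by linarith) hs0 hs1)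
  · rw [rho, if_neg (not_lt.2 hs1)]
    exact one_pos

end Hypergeometric

/-! ### The barrier and its Caputo derivative. -/

section Barrier

variable {a c τ t : ℝ}

lemma barrier_of_pos (ht : 0 < t) : barrier c τ t = (max τ t) ^ (c - 1) := if_pos ht

@[simp] lemma barrier_zero : barrier c τ 0 = 0 := if_neg (lt_irrefl 0)

lemma barrier_pos (ht : 0 < t) : 0 < barrier c τ t := by
  rw [barrier_of_pos ht]
  exact Real.rpow_pos_of_pos (lt_max_of_lt_right ht) _

lemma barrier_anti (hc1 : c < 1) {s : ℝ} (hs : 0 < s) (hst : s ≤ t) :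
    barrier c τ t ≤ barrier c τ s := by
  rw [barrier_of_pos hs, barrier_of_pos (hs.trans_le hst)]
  exact Real.rpow_le_rpow_of_nonpos (lt_max_of_lt_right hs) (max_le_max_left τ hst) (by linarith)

lemma barrier_le_rpow (hc1 : c < 1) (ht : 0 < t) : barrier c τ t ≤ t ^ (c - 1) := by
  rw [barrier_of_pos ht]
  exact Real.rpow_le_rpow_of_nonpos ht (le_max_right _ _) (by linarith)

lemma continuousOn_barrier : ContinuousOn (barrier c τ) (Ioi 0) := by
  have h : ContinuousOn (fun t : ℝ => (max τ t) ^ (c - 1)) (Ioi 0) :=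
    ContinuousOn.rpow_const (by fun_prop) fun x hx => Or.inl (lt_max_of_lt_right hx).ne'
  exact h.congr fun x hx => barrier_of_pos hx

lemma abs_barrier_sub_le (hc : 0 < c) (hc1 : c < 1) (hτ : 0 < τ) {s : ℝ} (hs : 0 < s)
    (hst : s ≤ t) : |barrier c τ t - barrier c τ s| ≤ τ ^ (c - 1) / t * (t - s) := by
  have ht : 0 < t := hs.trans_le hst
  rw [abs_sub_comm, abs_of_nonneg (sub_nonneg.2 (barrier_anti hc1 hs hst)), barrier_of_pos hs,
    barrier_of_pos ht]
  have hts : 0 ≤ t - s := by linarith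
  rcases le_or_gt t τ with h | h
  · rw [max_eq_left h, max_eq_left (hst.trans h), sub_self]
    positivity
  · set m := max τ s with hm
    have hm0 : 0 < m := lt_max_of_lt_left hτ
    have hmt : m ≤ t := max_le h.le hst
    rw [max_eq_right h.le]
    -- Since `m / t ≤ 1` and `1 - c ≤ 1`, the power is bounded below by its base, which makes the
    -- difference linear in `t - m`.
    have h₁ : m / t ≤ (m / t) ^ (1 - c) := by
      simpa using Real.rpow_le_rpow_of_exponent_ge (div_pos hm0 ht) ((div_le_one ht).2 hmt)
        (show 1 - c ≤ 1 by linarith)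
    have h₂ : t ^ (c - 1) = m ^ (c - 1) * (m / t) ^ (1 - c) := by
      rw [Real.div_rpow hm0.le ht.le, ← mul_div_assoc, ← Real.rpow_add hm0,
        show c - 1 + (1 - c) = 0 by ring, Real.rpow_zero, one_div, ← Real.rpow_neg ht.le, neg_sub]
    have h₃ : m ^ (c - 1) ≤ τ ^ (c - 1) :=
      Real.rpow_le_rpow_of_nonpos hτ (le_max_left _ _) (by linarith)
    have h₄ : 0 < m ^ (c - 1) := Real.rpow_pos_of_pos hm0 _
    calc m ^ (c - 1) - t ^ (c - 1) ≤ m ^ (c - 1) - m ^ (c - 1) * (m / t) := by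
          rw [h₂]
          exact sub_le_sub_left (mul_le_mul_of_nonneg_left h₁ h₄.le) _
      _ = m ^ (c - 1) * ((t - m) / t) := by field_simp
      _ ≤ τ ^ (c - 1) * ((t - s) / t) :=
          mul_le_mul h₃ (div_le_div_of_nonneg_right (by linarith [le_max_right τ s]) ht.le)
            (div_nonneg (by linarith) ht.le) (Real.rpow_nonneg hτ.le _)
      _ = τ ^ (c - 1) / t * (t - s) := by ring

lemma intervalIntegrable_caputo_barrier (ha1 : a < 1) (hc : 0 < c) (hc1 : c < 1) (hτ : 0 < τ)
    (ht : 0 < t) : IntervalIntegrable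
      (fun s => (a * (t - s) ^ (-a - 1)) • (barrier c τ t - barrier c τ s)) volume 0 t :=
  intervalIntegrable_caputo ha1 ht (continuousOn_barrier.mono fun _ hs => hs.1)
    fun _ hs => abs_barrier_sub_le hc hc1 hτ hs.1 hs.2.le

lemma hasDerivAt_sub_rpow {s : ℝ} (hst : s < t) (r : ℝ) :
    HasDerivAt (fun s => (t - s) ^ r) (-(r * (t - s) ^ (r - 1))) s := by
  have := ((hasDerivAt_id s).const_sub t).rpow_const (p := r) (Or.inl (sub_pos.2 hst).ne')
  simpa using this

lemma integral_mul_sub_rpow_neg (hτ : 0 < τ) (hτt : τ < t) :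
    ∫ s in (0 : ℝ)..τ, a * (t - s) ^ (-a - 1) = (t - τ) ^ (-a) - t ^ (-a) := by
  have hd : ∀ s ∈ uIcc 0 τ, HasDerivAt (fun s => (t - s) ^ (-a)) (a * (t - s) ^ (-a - 1)) s := by
    intro s hs
    rw [uIcc_of_le hτ.le] at hs
    simpa using hasDerivAt_sub_rpow (hs.2.trans_lt hτt) (-a)
  rw [intervalIntegral.integral_eq_sub_of_hasDerivAt hd, sub_zero]
  refine ContinuousOn.intervalIntegrable (continuousOn_const.mul
    (ContinuousOn.rpow_const (by fun_prop) fun s hs => ?_))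
  rw [uIcc_of_le hτ.le] at hs
  exact Or.inl (by linarith [hs.2])

lemma intervalIntegrable_rpow_mul_sub_rpow (ha1 : a < 1) (hτ : 0 < τ) (hτt : τ < t) :
    IntervalIntegrable (fun x => x ^ (c - 1) * (t - x) ^ (-a)) volume τ t := by
  refine IntervalIntegrable.continuousOn_mul ?_ ?_
  · exact (intervalIntegrable_sub_rpow (t := t) (by linarith)).mono_set
      (by rw [uIcc_of_le hτt.le, uIcc_of_le (hτ.trans hτt).le]
          exact Icc_subset_Icc_left hτ.le)
  · refine ContinuousOn.rpow_const (by fun_prop) fun x hx => ?_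
    rw [uIcc_of_le hτt.le] at hx
    exact Or.inl (by linarith [hx.1])

lemma tendsto_sub_rpow_mul_barrier_sub (ha1 : a < 1) (hc : 0 < c) (hc1 : c < 1) (hτ : 0 < τ)
    (ht : 0 < t) :
    Tendsto (fun s => (t - s) ^ (-a) * (barrier c τ t - barrier c τ s)) (𝓝[<] t) (𝓝 0) := by
  have hg : Tendsto (fun s => τ ^ (c - 1) / t * (t - s) ^ (1 - a)) (𝓝[<] t) (𝓝 0) := by
    have hc : Continuous fun s : ℝ => τ ^ (c - 1) / t * (t - s) ^ (1 - a) :=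
      continuous_const.mul ((continuous_const.sub continuous_id).rpow_const
        fun _ => Or.inr (by linarith))
    have := (hc.tendsto t).mono_left (nhdsWithin_le_nhds (s := Iio t))
    rwa [sub_self, Real.zero_rpow (by linarith), mul_zero] at this
  refine squeeze_zero_norm' ?_ hg
  filter_upwards [Ioo_mem_nhdsLT ht] with s hs
  have hts : 0 < t - s := sub_pos.2 hs.2
  rw [norm_mul, Real.norm_eq_abs, Real.norm_eq_abs, abs_of_nonneg (Real.rpow_nonneg hts.le _)]
  calc _ ≤ (t - s) ^ (-a) * (τ ^ (c - 1) / t * (t - s)) :=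
        mul_le_mul_of_nonneg_left (abs_barrier_sub_le hc hc1 hτ hs.1 hs.2.le)
          (Real.rpow_nonneg hts.le _)
    _ = _ := by
        rw [show (1 - a) = -a + 1 by ring, Real.rpow_add_one hts.ne']
        ring

lemma integral_caputo_barrier_tail (ha1 : a < 1) (hc : 0 < c) (hc1 : c < 1) (hτ : 0 < τ)
    (hτt : τ < t) :
    ∫ s in τ..t, (a * (t - s) ^ (-a - 1)) • (barrier c τ t - barrier c τ s) =
      t⁻¹ * (c - a) * (∫ x in τ..t, x ^ (c - 1) * (t - x) ^ (-a)) -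
        (t - τ) ^ (-a) * (t ^ (c - 1) - τ ^ (c - 1)) - t⁻¹ * τ ^ (c - 1) * (t - τ) ^ (1 - a) := by
  have ht : 0 < t := hτ.trans hτt
  have hK := intervalIntegrable_rpow_mul_sub_rpow (c := c) ha1 hτ hτt
  have hbar : ∀ {s}, τ ≤ s → barrier c τ s = s ^ (c - 1) := fun h => by
    rw [barrier_of_pos (hτ.trans_le h), max_eq_right h]
  set K : ℝ → ℝ := fun s => ∫ x in τ..s, x ^ (c - 1) * (t - x) ^ (-a) with hKdef
  have hKc : ContinuousOn K (uIcc τ t) :=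
    intervalIntegral.continuousOn_primitive_interval' hK left_mem_uIcc
  rw [uIcc_of_le hτt.le] at hKc
  have hKd : ∀ s ∈ Ioo τ t, HasDerivAt K (s ^ (c - 1) * (t - s) ^ (-a)) s := by
    intro s hs
    have hcont : ∀ x ∈ Ioo τ t, ContinuousAt (fun x => x ^ (c - 1) * (t - x) ^ (-a)) x := by
      intro x hx
      refine (Real.continuousAt_rpow_const _ _ (Or.inl (hτ.trans hx.1).ne')).mul ?_
      exact ContinuousAt.rpow_const (by fun_prop) (Or.inl (sub_pos.2 hx.2).ne')
    refine intervalIntegral.integral_hasDerivAt_right (hK.mono_set ?_) ?_ (hcont s hs)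
    · rw [uIcc_of_le hs.1.le, uIcc_of_le hτt.le]
      exact Icc_subset_Icc_right hs.2.le
    · exact ContinuousOn.stronglyMeasurableAtFilter isOpen_Ioo
        (fun x hx => (hcont x hx).continuousWithinAt) s hs
  -- Integration by parts leaves `(c - 1) * s ^ (c - 2) * (t - s) ^ (-a)`. Up to the factor `t⁻¹`,
  -- this is the derivative of `s ^ (c - 1) * (t - s) ^ (1 - a)` plus `(c - a) * s ^ (c - 1) * (t -
  -- s) ^ (-a)`, whose primitive is `K`. One-sided limits replace endpoint values because of the
  -- singularity at `t`.
  have hF := intervalIntegral.integral_eq_sub_of_hasDerivAt_of_tendsto hτt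
    (f := fun s => (t - s) ^ (-a) * (t ^ (c - 1) - s ^ (c - 1)) +
      t⁻¹ * (s ^ (c - 1) * (t - s) ^ (1 - a)) + t⁻¹ * (c - a) * K s)
    (f' := fun s => (a * (t - s) ^ (-a - 1)) • (barrier c τ t - barrier c τ s))
    (fa := (t - τ) ^ (-a) * (t ^ (c - 1) - τ ^ (c - 1)) +
      t⁻¹ * (τ ^ (c - 1) * (t - τ) ^ (1 - a)))
    (fb := t⁻¹ * (c - a) * K t) ?_ ?_ ?_ ?_
  · rw [hF]
    ring
  · intro s hs
    have hs0 : 0 < s := hτ.trans hs.1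
    have hts : 0 < t - s := sub_pos.2 hs.2
    have d₁ := hasDerivAt_sub_rpow hs.2 (-a)
    have d₂ := hasDerivAt_sub_rpow hs.2 (1 - a)
    have d₃ : HasDerivAt (fun s : ℝ => s ^ (c - 1)) ((c - 1) * s ^ (c - 1 - 1)) s :=
      Real.hasDerivAt_rpow_const (Or.inl hs0.ne')
    refine (((d₁.mul (d₃.const_sub (t ^ (c - 1)))).add ((d₃.mul d₂).const_mul t⁻¹)).add
      ((hKd s hs).const_mul (t⁻¹ * (c - a)))).congr_deriv ?_
    rw [hbar hτt.le, hbar hs.1.le, smul_eq_mul, show 1 - a - 1 = -a by ring,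
      show 1 - a = -a + 1 by ring, Real.rpow_add_one hts.ne', Real.rpow_sub_one hs0.ne' (c - 1)]
    generalize s ^ (c - 1) = A
    generalize (t - s) ^ (-a) = B
    generalize (t - s) ^ (-a - 1) = B'
    field_simp
    ring
  · exact (intervalIntegrable_caputo_barrier ha1 hc hc1 hτ ht).mono_set
      (by rw [uIcc_of_le hτt.le, uIcc_of_le ht.le]; exact Icc_subset_Icc_left hτ.le)
  · have e₁ : ContinuousAt (fun s : ℝ => s ^ (c - 1)) τ :=
      Real.continuousAt_rpow_const _ _ (Or.inl hτ.ne')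
    have e₂ : ∀ r : ℝ, ContinuousAt (fun s : ℝ => (t - s) ^ r) τ := fun r =>
      ContinuousAt.rpow_const (by fun_prop) (Or.inl (sub_pos.2 hτt).ne')
    have e₃ : Tendsto K (𝓝[>] τ) (𝓝 0) := by
      have := (hKc τ (left_mem_Icc.2 hτt.le)).tendsto
      rw [show K τ = 0 from intervalIntegral.integral_same] at this
      exact this.mono_left (nhdsWithin_le_of_mem (Icc_mem_nhdsGT hτt))
    have e₄ : ContinuousAt (fun s : ℝ => (t - s) ^ (-a) * (t ^ (c - 1) - s ^ (c - 1)) +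
        t⁻¹ * (s ^ (c - 1) * (t - s) ^ (1 - a))) τ :=
      ((e₂ _).mul (continuousAt_const.sub e₁)).add (continuousAt_const.mul (e₁.mul (e₂ _)))
    simpa using (e₄.tendsto.mono_left nhdsWithin_le_nhds).add (e₃.const_mul (t⁻¹ * (c - a)))
  · have e₁ : Tendsto (fun s => (t - s) ^ (-a) * (t ^ (c - 1) - s ^ (c - 1))) (𝓝[<] t)
        (𝓝 0) := by
      refine (tendsto_sub_rpow_mul_barrier_sub ha1 hc hc1 hτ ht).congr' ?_
      filter_upwards [Ioo_mem_nhdsLT hτt] with s hs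
      rw [hbar hτt.le, hbar hs.1.le]
    have e₂ : Tendsto (fun s => t⁻¹ * (s ^ (c - 1) * (t - s) ^ (1 - a))) (𝓝[<] t) (𝓝 0) := by
      have h₁ : ContinuousAt (fun s : ℝ => s ^ (c - 1)) t :=
        Real.continuousAt_rpow_const _ _ (Or.inl ht.ne')
      have h₂ : ContinuousAt (fun s : ℝ => (t - s) ^ (1 - a)) t :=
        ContinuousAt.rpow_const (by fun_prop) (Or.inr (by linarith))
      have : Tendsto (fun s => t⁻¹ * (s ^ (c - 1) * (t - s) ^ (1 - a))) (𝓝[<] t)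
          (𝓝 (t⁻¹ * (t ^ (c - 1) * (t - t) ^ (1 - a)))) :=
        (continuousAt_const.mul (h₁.mul h₂)).tendsto.mono_left nhdsWithin_le_nhds
      rwa [sub_self, Real.zero_rpow (by linarith : 1 - a ≠ 0), mul_zero, mul_zero] at this
    have e₃ : Tendsto K (𝓝[<] t) (𝓝 (K t)) :=
      (hKc t (right_mem_Icc.2 hτt.le)).tendsto.mono_left
        (nhdsWithin_le_of_mem (Icc_mem_nhdsLT hτt))
    simpa using (e₁.add e₂).add (e₃.const_mul (t⁻¹ * (c - a)))

/-- The Caputo derivative of the barrier. -/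
lemma caputo_barrier (ha : 0 < a) (ha1 : a < 1) (hc : 0 < c) (hc1 : c < 1) (hτ : 0 < τ)
    (ht : 0 < t) :
    caputo a (barrier c τ) t =
      (Real.Gamma (1 - a))⁻¹ * (τ ^ (c - 1) * t ^ (-a) * (1 - rho c a (τ / t))) := by
  rw [caputo, smul_eq_mul, smul_eq_mul, barrier_zero, sub_zero]
  congr 1
  -- For `t ≤ τ` the barrier is constant on `(0, t]`, so only its jump at zero contributes.
  rcases le_or_gt t τ with h | h
  · have hz : ∫ s in (0 : ℝ)..t, (a * (t - s) ^ (-a - 1)) • (barrier c τ t - barrier c τ s)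
        = 0 := by
      refine intervalIntegral.integral_zero_ae (ae_of_all _ fun s hs => ?_)
      rw [uIoc_of_le ht.le] at hs
      rw [barrier_of_pos ht, barrier_of_pos hs.1, max_eq_left h, max_eq_left (hs.2.trans h),
        sub_self, smul_zero]
    rw [hz, rho, if_neg (not_lt.2 ((one_le_div ht).2 h)), barrier_of_pos ht, max_eq_left h]
    ring
  · have hi := intervalIntegrable_caputo_barrier ha1 hc hc1 hτ ht
    have hsplit := intervalIntegral.integral_add_adjacent_intervals
      (hi.mono_set (c := 0) (d := τ) (by
        rw [uIcc_of_le hτ.le, uIcc_of_le ht.le]; exact Icc_subset_Icc_right h.le))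
      (hi.mono_set (c := τ) (d := t) (by
        rw [uIcc_of_le h.le, uIcc_of_le ht.le]; exact Icc_subset_Icc_left hτ.le))
    have hE : barrier c τ t = t ^ (c - 1) := by rw [barrier_of_pos ht, max_eq_right h.le]
    have h₁ : ∫ s in (0 : ℝ)..τ, (a * (t - s) ^ (-a - 1)) • (barrier c τ t - barrier c τ s) =
        ((t - τ) ^ (-a) - t ^ (-a)) * (t ^ (c - 1) - τ ^ (c - 1)) := by
      rw [← integral_mul_sub_rpow_neg hτ h, ← intervalIntegral.integral_mul_const]
      refine intervalIntegral.integral_congr_ae (ae_of_all _ fun s hs => ?_)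
      rw [uIoc_of_le hτ.le] at hs
      rw [hE, barrier_of_pos hs.1, max_eq_left hs.2, smul_eq_mul]
    have hx0 : 0 < τ / t := div_pos hτ ht
    have hx1 : τ / t < 1 := (div_lt_one ht).2 h
    -- Rescaling by `t` produces the tail integral of `rho_eq` at `s = τ / t`.
    have hK : ∫ x in τ..t, x ^ (c - 1) * (t - x) ^ (-a) =
        t * (t ^ (c - 1) * t ^ (-a)) * ∫ x in (τ / t)..1, x ^ (c - 1) * (1 - x) ^ (-a) := by
      have hsub := intervalIntegral.integral_comp_mul_left (a := τ / t) (b := 1)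
        (fun x => x ^ (c - 1) * (t - x) ^ (-a)) ht.ne'
      rw [mul_div_cancel₀ _ ht.ne', mul_one, smul_eq_mul, eq_inv_mul_iff_mul_eq₀ ht.ne'] at hsub
      rw [← hsub, mul_assoc t, ← intervalIntegral.integral_const_mul (t ^ (c - 1) * t ^ (-a))]
      congr 1
      refine intervalIntegral.integral_congr fun x hx => ?_
      rw [uIcc_of_le hx1.le] at hx
      have hx' : 0 ≤ x := hx0.le.trans hx.1
      have h1x : 0 ≤ 1 - x := by linarith [hx.2]
      rw [show t - t * x = t * (1 - x) by ring, Real.mul_rpow ht.le hx', Real.mul_rpow ht.le h1x]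
      ring
    rw [← hsplit, h₁, integral_caputo_barrier_tail ha1 hc hc1 hτ h, hK, hE,
      rho_eq ha ha1 hc hc1 hx0 hx1]
    have e₁ : (1 - τ / t) ^ (1 - a) = (t - τ) ^ (1 - a) * (t⁻¹ * (t ^ (-a))⁻¹) := by
      rw [show 1 - τ / t = (t - τ) / t by field_simp, Real.div_rpow (by linarith) ht.le,
        show (1 - a) = -a + 1 by ring, Real.rpow_add_one ht.ne', div_eq_mul_inv, mul_inv, mul_comm _ t⁻¹]
    have e₂ : τ ^ (c - 1) * (τ / t) ^ (1 - c) = t ^ (c - 1) := by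
      rw [Real.div_rpow hτ.le ht.le, ← mul_div_assoc, ← Real.rpow_add hτ,
        show c - 1 + (1 - c) = 0 by ring, Real.rpow_zero, one_div, ← Real.rpow_neg ht.le, neg_sub]
    have hta : t ^ (-a) ≠ 0 := (Real.rpow_pos_of_pos ht _).ne'
    rw [e₁, ← e₂]
    field_simp
    ring

end Barrier

/-! ### Comparison of the error norm with the barrier. -/

section Comparison

variable {ℓ : ℕ}

/-- This is the origin of the weight: it is the image of the barrier under `∑ q_i D^{α_i} + λ`. -/
lemma residualWeight_eq [NeZero ℓ] {α : Fin ℓ → ℝ} (hα_anti : StrictAnti α)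
    (hα_pos : ∀ i, 0 < α i) (hα_lt : α 0 < 1) (q : Fin ℓ → ℝ → ℝ) (lam : ℝ) {τ t : ℝ}
    (hτ : 0 < τ) (ht : 0 < t) :
    residualWeight α q lam τ t = lam * barrier (α 0) τ t +
      ∑ i, q i t * caputo (α i) (barrier (α 0) τ) t := by
  rw [residualWeight, Finset.mul_sum]
  congr 1
  refine Finset.sum_congr rfl fun i _ => ?_
  rw [caputo_barrier (hα_pos i) ((hα_anti.antitone (Fin.zero_le _)).trans_lt hα_lt) (hα_pos 0)
    hα_lt hτ ht, neg_sub]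
  ring

lemma residualWeight_pos [NeZero ℓ] {α : Fin ℓ → ℝ} (hα_anti : StrictAnti α)
    (hα_pos : ∀ i, 0 < α i) (hα_lt : α 0 < 1) {q : Fin ℓ → ℝ → ℝ} {lam τ t : ℝ}
    (hlam : 0 ≤ lam) (hτ : 0 < τ) (ht : 0 < t) (hq : ∀ i, 0 ≤ q i t) (hqs : 0 < ∑ i, q i t) :
    0 < residualWeight α q lam τ t := by
  have hα0 : ∀ i, α i ≤ α 0 := fun i => hα_anti.antitone (Fin.zero_le _)
  have hk : ∀ i, 0 < t ^ (-α i) / Real.Gamma (1 - α i) * (1 - rho (α 0) (α i) (τ / t)) :=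
    fun i => mul_pos (div_pos (Real.rpow_pos_of_pos ht _)
      (Real.Gamma_pos_of_pos (by linarith [hα0 i])))
      (sub_pos.2 (rho_lt_one (hα_pos i) (hα0 i) hα_lt (div_pos hτ ht)))
  obtain ⟨j, -, hj⟩ := Finset.exists_lt_of_sum_lt
    (show ∑ i : Fin ℓ, (0 : ℝ) < ∑ i, q i t by simpa using hqs)
  refine add_pos_of_nonneg_of_pos (mul_nonneg hlam (barrier_pos ht).le)
    (mul_pos (Real.rpow_pos_of_pos hτ _) ?_)
  simp only [mul_div_assoc, mul_assoc] at hk ⊢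
  exact Finset.sum_pos' (fun i _ => mul_nonneg (hq i) (hk i).le)
    ⟨j, Finset.mem_univ j, mul_pos hj (hk j)⟩

/-- Minimum principle: a function satisfying the energy inequality with right-hand side
`M * residualWeight` is bounded by `M * barrier`. -/
lemma norm_le_mul_barrier [NeZero ℓ] {H : Type*} [NormedAddCommGroup H] [InnerProductSpace ℝ H]
    [CompleteSpace H] {α : Fin ℓ → ℝ} (hα_anti : StrictAnti α)
    (hα_pos : ∀ i, 0 < α i) (hα_lt : α 0 < 1) {q : Fin ℓ → ℝ → ℝ} {lam τ t M : ℝ}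
    (hlam : 0 ≤ lam) (hτ : 0 < τ) (ht : 0 < t) (hM : 0 < M)
    (hq : ∀ i, ∀ s ∈ Ioc 0 t, 0 ≤ q i s) (hqs : ∀ s ∈ Ioc 0 t, 0 < ∑ i, q i s) {e : ℝ → H}
    (he : ContinuousOn e (Icc 0 t)) (he0 : e 0 = 0)
    (hint : ∀ i, ∀ s ∈ Ioc 0 t, IntervalIntegrable
      (fun r => (α i * (s - r) ^ (-α i - 1)) • (e s - e r)) volume 0 s)
    (hen : ∀ s ∈ Ioc 0 t, inner ℝ (multiCaputo α q e s) (e s) + lam * ‖e s‖ ^ 2 ≤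
      M * residualWeight α q lam τ s * ‖e s‖) :
    ‖e t‖ ≤ M * barrier (α 0) τ t := by
  by_contra! hcon
  have hMt : 0 < M * barrier (α 0) τ t := mul_pos hM (barrier_pos ht)
  -- The barrier is discontinuous at zero, so the minimum is sought on `[δ, t]`. On `(0, δ]`
  -- continuity keeps `‖e‖` below `M * barrier` at time `t`, the least value on `(0, t]`.
  obtain ⟨δ, hδ, hsmall⟩ : ∃ δ ∈ Ioo 0 t, ∀ s ∈ Ioc 0 δ,
      ‖e s‖ ≤ M * barrier (α 0) τ s := by
    have hc : ContinuousWithinAt (fun s => ‖e s‖) (Icc 0 t) 0 :=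
      (he 0 (left_mem_Icc.2 ht.le)).norm
    have hlt : ∀ᶠ s in 𝓝[Icc 0 t] 0, ‖e s‖ < M * barrier (α 0) τ t :=
      hc.eventually (gt_mem_nhds (by simpa [he0] using hMt))
    rw [eventually_nhdsWithin_iff, Metric.eventually_nhds_iff] at hlt
    obtain ⟨ε, hε, h⟩ := hlt
    refine ⟨min (ε / 2) (t / 2), ⟨by positivity, ?_⟩, fun s hs => ?_⟩
    · exact (min_le_right _ _).trans_lt (half_lt_self ht)
    · have h₁ : s ≤ ε / 2 := hs.2.trans (min_le_left _ _)
      have h₂ : s ≤ t / 2 := hs.2.trans (min_le_right _ _)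
      have := h (y := s) (by rw [Real.dist_eq, sub_zero, abs_of_pos hs.1]; linarith)
        ⟨hs.1.le, by linarith⟩
      exact this.le.trans (mul_le_mul_of_nonneg_left
        (barrier_anti hα_lt hs.1 (by linarith)) hM.le)
  have hcont : ContinuousOn (fun s => M * barrier (α 0) τ s - ‖e s‖) (Icc δ t) :=
    (continuousOn_const.mul (continuousOn_barrier.mono fun s hs => hδ.1.trans_le hs.1)).sub
      (he.mono (Icc_subset_Icc_left hδ.1.le)).norm
  obtain ⟨r, hr, hmin⟩ := isCompact_Icc.exists_isMinOn (nonempty_Icc.2 hδ.2.le) hcont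
  have hr0 : 0 < r := hδ.1.trans_le hr.1
  have hrt : r ∈ Ioc 0 t := ⟨hr0, hr.2⟩
  have hneg : M * barrier (α 0) τ r < ‖e r‖ := by
    have : M * barrier (α 0) τ r - ‖e r‖ ≤ M * barrier (α 0) τ t - ‖e t‖ :=
      hmin (right_mem_Icc.2 hδ.2.le)
    linarith
  -- The minimum over `[δ, t]` is negative and the difference is nonnegative on `(0, δ]`, so `r` is
  -- minimal against all earlier positive times.
  have hmin' : ∀ s ∈ Ioo 0 r,
      M * barrier (α 0) τ r - M * barrier (α 0) τ s ≤ ‖e r‖ - ‖e s‖ := by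
    intro s hs
    rcases le_or_gt s δ with h | h
    · linarith [hsmall s ⟨hs.1, h⟩]
    · have : M * barrier (α 0) τ r - ‖e r‖ ≤ M * barrier (α 0) τ s - ‖e s‖ :=
        hmin ⟨h.le, hs.2.le.trans hr.2⟩
      linarith
  have hpos : 0 < ‖e r‖ := (mul_pos hM (barrier_pos hr0)).trans hneg
  have hα1 : ∀ i, α i < 1 := fun i => (hα_anti.antitone (Fin.zero_le _)).trans_lt hα_lt
  have hterm : ∀ i, ‖e r‖ * (q i r * (M * caputo (α i) (barrier (α 0) τ) r)) +
      ‖e r‖ * (‖e r‖ - M * barrier (α 0) τ r) *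
        (q i r * ((Real.Gamma (1 - α i))⁻¹ * r ^ (-α i))) ≤
      inner ℝ (q i r • caputo (α i) e r) (e r) := by
    intro i
    have hb := intervalIntegrable_caputo_barrier (hα1 i) (hα_pos 0) hα_lt hτ hr0
    have heq : ∀ s, (α i * (r - s) ^ (-α i - 1)) •
        (M * barrier (α 0) τ r - M * barrier (α 0) τ s) =
        M * ((α i * (r - s) ^ (-α i - 1)) • (barrier (α 0) τ r - barrier (α 0) τ s)) := by
      intro s
      simp only [smul_eq_mul]
      ring
    have hcap : caputo (α i) (fun s => M * barrier (α 0) τ s) r =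
        M * caputo (α i) (barrier (α 0) τ) r := by
      simp only [caputo, heq, intervalIntegral.integral_const_mul, smul_eq_mul]
      ring
    have h := mul_caputo_le_inner_caputo (b := fun s => M * barrier (α 0) τ s) (hα_pos i) (hα1 i)
      hr0 (hint i r hrt) (by simpa only [heq] using hb.const_mul M) he0 (by simp) hmin'
    rw [hcap] at h
    rw [real_inner_smul_left]
    refine le_trans (le_of_eq ?_) (mul_le_mul_of_nonneg_left h (hq i r hrt))
    ring
  have hsum := Finset.sum_le_sum fun i (_ : i ∈ Finset.univ) => hterm i
  rw [Finset.sum_add_distrib, ← Finset.mul_sum, ← Finset.mul_sum, ← sum_inner] at hsum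
  have hE := hen r hrt
  rw [multiCaputo, residualWeight_eq hα_anti hα_pos hα_lt q lam hτ hr0] at hE
  have hMsum : ∑ i, q i r * (M * caputo (α i) (barrier (α 0) τ) r) =
      M * ∑ i, q i r * caputo (α i) (barrier (α 0) τ) r := by
    rw [Finset.mul_sum]
    exact Finset.sum_congr rfl fun i _ => by ring
  rw [hMsum] at hsum
  -- The surplus is strictly positive because some `q i r` is; this gives the contradiction even
  -- when `lam = 0`.
  have hS : 0 < ∑ i, q i r * ((Real.Gamma (1 - α i))⁻¹ * r ^ (-α i)) := by
    have hk : ∀ i, 0 < (Real.Gamma (1 - α i))⁻¹ * r ^ (-α i) := fun i =>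
      mul_pos (inv_pos.2 (Real.Gamma_pos_of_pos (by linarith [hα1 i])))
        (Real.rpow_pos_of_pos hr0 _)
    obtain ⟨j, -, hj⟩ := Finset.exists_lt_of_sum_lt
      (show ∑ i : Fin ℓ, (0 : ℝ) < ∑ i, q i r by simpa using hqs r hrt)
    exact Finset.sum_pos' (fun i _ => mul_nonneg (hq i r hrt) (hk i).le)
      ⟨j, Finset.mem_univ j, mul_pos hj (hk j)⟩
  have h₁ : 0 < ‖e r‖ * (‖e r‖ - M * barrier (α 0) τ r) *
      ∑ i, q i r * ((Real.Gamma (1 - α i))⁻¹ * r ^ (-α i)) :=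
    mul_pos (mul_pos hpos (sub_pos.2 hneg)) hS
  have h₂ : 0 ≤ lam * ‖e r‖ * (‖e r‖ - M * barrier (α 0) τ r) :=
    mul_nonneg (mul_nonneg hlam hpos.le) (sub_nonneg.2 hneg.le)
  linarith

end Comparison

/-! ### The energy inequality for the error and the passage to extended norms. -/

section Error

variable {d ℓ : ℕ} {Ω : Set (Space d)}

lemma multiCaputo_sub {X : Type*} [NormedAddCommGroup X] [NormedSpace ℝ X] {α : Fin ℓ → ℝ}
    {q : Fin ℓ → ℝ → ℝ} {y z : ℝ → X} {t : ℝ}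
    (hy : ∀ i, IntervalIntegrable
      (fun s => (α i * (t - s) ^ (-α i - 1)) • (y t - y s)) volume 0 t)
    (hz : ∀ i, IntervalIntegrable
      (fun s => (α i * (t - s) ^ (-α i - 1)) • (z t - z s)) volume 0 t) :
    multiCaputo α q (fun s => y s - z s) t = multiCaputo α q y t - multiCaputo α q z t := by
  simp only [multiCaputo, caputo_sub (hy _) (hz _), smul_sub, Finset.sum_sub_distrib]

/-- The energy inequality satisfied by the error at a time at which the residual is represented
by `g ∈ L_2(Ω)`. -/
lemma inner_multiCaputo_error_le (hΩ : IsOpen Ω) {L : EllipticOperator Ω} {T : ℝ}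
    {α : Fin ℓ → ℝ} (hα1 : ∀ i, α i < 1) {q : Fin ℓ → ℝ → ℝ} {lam : ℝ}
    (hL : ∀ r : L2 Ω, MemH10 Ω r → lam * ‖r‖ ^ 2 ≤ L.pairing r r)
    {f : ℝ → Space d → ℝ} {u₀ : L2 Ω} {u uh : ℝ → L2 Ω} (hu_sol : IsSolution L T α q f u₀ u)
    (hu_reg : TimeRegular T u) (huh_reg : TimeRegular T uh)
    (huh_H10 : ∀ t ∈ Ioc 0 T, MemH10 Ω (uh t)) {t : ℝ} (ht : t ∈ Ioc 0 T) {g : L2 Ω}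
    (hg : ∀ φ : Space d → ℝ, IsTestFunction Ω φ →
      residual L α q f uh t φ = ∫ x in Ω, g x * φ x) :
    inner ℝ (multiCaputo α q (fun s => uh s - u s) t) (uh t - u t) + lam * ‖uh t - u t‖ ^ 2 ≤
      ‖g‖ * ‖uh t - u t‖ := by
  have hm := multiCaputo_sub (q := q) (fun i => huh_reg.intervalIntegrable_caputo ht (hα1 i))
    (fun i => hu_reg.intervalIntegrable_caputo ht (hα1 i))
  have hsub := Lp.coeFn_sub (uh t) (u t)
  have hwu := (hu_sol.boundary t ht).hasWeakGradient
  have hwh := (huh_H10 t ht).hasWeakGradient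
  have hH10 : MemH10 Ω (uh t - u t : L2 Ω) :=
    ((huh_H10 t ht).sub (hu_sol.boundary t ht)).congr hsub.symm
  -- Subtracting the weak equation for `u` from the residual identity eliminates `f` and leaves an
  -- identity for the error alone.
  have key := L.inner_add_pairing_self hΩ (w := uh t - u t)
    (m := multiCaputo α q (fun s => uh s - u s) t) (g := g) hH10 fun φ hφ => by
      rw [← hg φ hφ, residual, ← hu_sol.equation t ht φ hφ, operatorPairing, operatorPairing,
        L.pairing_sub hΩ hwh hwu hsub hφ.hasWeakGradient, hm, add_sub_add_comm]
      congr 1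
      simp only [← smul_eq_mul]
      rw [← integral_sub (integrable_smul_of_memLp_two (Lp.memLp _) hφ.memLp)
        (integrable_smul_of_memLp_two (Lp.memLp _) hφ.memLp)]
      refine integral_congr_ae ?_
      filter_upwards [Lp.coeFn_sub (multiCaputo α q uh t) (multiCaputo α q u t)] with x hx
      rw [hx, Pi.sub_apply, sub_smul]
  linarith [hL _ hH10, real_inner_le_norm g (uh t - u t)]

end Error

/-- Working with a strict bound on the infimum provides a representative directly, so neither
attainment nor uniqueness is needed. -/
lemma exists_norm_lt_of_distribL2Norm_lt {d : ℕ} {Ω : Set (Space d)} {S : (Space d → ℝ) → ℝ}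
    {R : ℝ} (h : distribL2Norm Ω S < ENNReal.ofReal R) :
    ∃ g : L2 Ω, (∀ φ : Space d → ℝ, IsTestFunction Ω φ → S φ = ∫ x in Ω, g x * φ x) ∧
      ‖g‖ < R := by
  obtain ⟨g, hg⟩ := iInf_lt_iff.1 h
  obtain ⟨hrep, hlt⟩ := iInf_lt_iff.1 hg
  rw [← ofReal_norm, ENNReal.ofReal_lt_ofReal_iff_of_nonneg (norm_nonneg _)] at hlt
  exact ⟨g, hrep, hlt⟩

lemma enorm_le_ofReal_mul_of_forall_lt {E : Type*} [NormedAddCommGroup E] {x : E} {b : ℝ}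
    {S : ℝ≥0∞} (hb : 0 < b) (h : ∀ M : ℝ, S < ENNReal.ofReal M → ‖x‖ ≤ M * b) :
    ‖x‖ₑ ≤ ENNReal.ofReal b * S := by
  rcases eq_or_ne S ∞ with rfl | hS
  · rw [ENNReal.mul_top (ENNReal.ofReal_pos.2 hb).ne']
    exact le_top
  have hle : ‖x‖ / b ≤ S.toReal := le_of_forall_gt_imp_ge_of_dense fun M hM => by
    rw [div_le_iff₀ hb]
    exact h M ((ENNReal.lt_ofReal_iff_toReal_lt hS).2 hM)
  rw [← ENNReal.ofReal_toReal hS, ← ENNReal.ofReal_mul hb.le, ← ofReal_norm]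
  refine ENNReal.ofReal_le_ofReal ?_
  rwa [div_le_iff₀' hb] at hle

end Subdiffusion

end

theorem corollary3p4 {d : ℕ} (hd : d = 1 ∨ d = 2 ∨ d = 3)
    (Ω : Set (Subdiffusion.Space d)) (hΩ_open : IsOpen Ω) (hΩ_bdd : Bornology.IsBounded Ω)
    (T : ℝ) (hT : 0 < T)
    {ℓ : ℕ} [NeZero ℓ]
    (α : Fin ℓ → ℝ) (hα_anti : StrictAnti α) (hα_pos : ∀ i, 0 < α i) (hα_lt : α 0 < 1)
    (q : Fin ℓ → ℝ → ℝ) (hq_cont : ∀ i, ContinuousOn (q i) (Set.Icc 0 T))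
    (hq_nonneg : ∀ i, ∀ t ∈ Set.Icc 0 T, 0 ≤ q i t)
    (hq_sum : ∀ t ∈ Set.Icc 0 T, 0 < ∑ i, q i t)
    (L : Subdiffusion.EllipticOperator Ω)
    (lam : ℝ) (hlam : 0 ≤ lam)
    (hL : ∀ r : Subdiffusion.L2 Ω, Subdiffusion.MemH10 Ω r → lam * ‖r‖ ^ 2 ≤ L.pairing r r)
    (f : ℝ → Subdiffusion.Space d → ℝ)
    (hf : ∀ t ∈ Set.Ioc 0 T, MeasureTheory.LocallyIntegrableOn (f t) Ω MeasureTheory.volume)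
    (u₀ : Subdiffusion.L2 Ω) (u uh : ℝ → Subdiffusion.L2 Ω)
    (hu_sol : Subdiffusion.IsSolution L T α q f u₀ u)
    (hu_reg : Subdiffusion.TimeRegular T u)
    (huh_reg : Subdiffusion.TimeRegular T uh)
    (huh_H10 : ∀ t ∈ Set.Ioc 0 T, Subdiffusion.MemH10 Ω (uh t))
    (huh_init : uh 0 = u 0)
    (τ : ℝ) (hτ : 0 < τ) :
    (∀ i, ∀ s ∈ Set.Ioo (0 : ℝ) 1,
      Subdiffusion.rho (α 0) (α i) s ≤ (1 - s) ^ (1 - α i) ∧ (1 - s) ^ (1 - α i) < 1) ∧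
    ∀ t ∈ Set.Ioc 0 T,
      ‖uh t - u t‖ₑ ≤ ENNReal.ofReal (t ^ (α 0 - 1)) *
          ⨆ s ∈ Set.Ioc 0 t,
            Subdiffusion.distribL2Norm Ω (Subdiffusion.residual L α q f uh s) /
              ENNReal.ofReal (Subdiffusion.residualWeight α q lam τ s) ∧
      ‖uh t - u t‖ₑ ≤ ENNReal.ofReal (Subdiffusion.barrier (α 0) τ t) *
          ⨆ s ∈ Set.Ioc 0 t,
            Subdiffusion.distribL2Norm Ω (Subdiffusion.residual L α q f uh s) /
              ENNReal.ofReal (Subdiffusion.residualWeight α q lam τ s) := by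
  open Subdiffusion in
  have hα0 : ∀ i, α i ≤ α 0 := fun i => hα_anti.antitone (Fin.zero_le _)
  have hα1 : ∀ i, α i < 1 := fun i => (hα0 i).trans_lt hα_lt
  refine ⟨fun i s hs => ⟨rho_le (hα_pos i) (hα0 i) hα_lt hs.1 hs.2,
    one_sub_rpow_lt_one (hα1 i) hs.1 hs.2⟩, fun t ht => ?_⟩
  set S := ⨆ s ∈ Ioc 0 t, distribL2Norm Ω (residual L α q f uh s) /
    ENNReal.ofReal (residualWeight α q lam τ s) with hS
  have hmem : ∀ s ∈ Ioc 0 t, s ∈ Ioc 0 T := fun s hs => ⟨hs.1, hs.2.trans ht.2⟩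
  have hmem' : ∀ s ∈ Ioc 0 t, s ∈ Icc 0 T := fun s hs => Ioc_subset_Icc_self (hmem s hs)
  have hE : ‖uh t - u t‖ₑ ≤ ENNReal.ofReal (barrier (α 0) τ t) * S := by
    -- Any real `M` above the supremum serves as the comparison constant. The strict inequality
    -- makes every residual on `(0, t]` representable in `L_2`, with norm below `M *
    -- residualWeight`.
    refine enorm_le_ofReal_mul_of_forall_lt (barrier_pos ht.1) fun M hM => ?_
    have hM0 : 0 < M := ENNReal.ofReal_pos.1 (zero_le.trans_lt hM)
    refine norm_le_mul_barrier (e := fun s => uh s - u s) hα_anti hα_pos hα_lt hlam hτ ht.1 hM0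
      (fun i s hs => hq_nonneg i s (hmem' s hs)) (fun s hs => hq_sum s (hmem' s hs))
      ((huh_reg.1.sub hu_reg.1).mono (Icc_subset_Icc_right ht.2)) (by simp [huh_init])
      (fun i s hs => ?_) fun s hs => ?_
    · refine ((huh_reg.intervalIntegrable_caputo (hmem s hs) (hα1 i)).sub
        (hu_reg.intervalIntegrable_caputo (hmem s hs) (hα1 i))).congr fun r _ => ?_
      simp only [← smul_sub, sub_sub_sub_comm]
    · have hW := residualWeight_pos hα_anti hα_pos hα_lt (q := q) hlam hτ hs.1
        (fun i => hq_nonneg i s (hmem' s hs)) (hq_sum s (hmem' s hs))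
      have hlt : distribL2Norm Ω (residual L α q f uh s) <
          ENNReal.ofReal (M * residualWeight α q lam τ s) := by
        rw [ENNReal.ofReal_mul hM0.le, ← ENNReal.div_lt_iff
          (Or.inl (ENNReal.ofReal_pos.2 hW).ne') (Or.inl ENNReal.ofReal_ne_top)]
        refine lt_of_le_of_lt ?_ hM
        exact le_iSup₂ (f := fun s (_ : s ∈ Ioc 0 t) => distribL2Norm Ω
          (residual L α q f uh s) / ENNReal.ofReal (residualWeight α q lam τ s)) s hs
      obtain ⟨g, hg, hgn⟩ := exists_norm_lt_of_distribL2Norm_lt hlt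
      refine (inner_multiCaputo_error_le hΩ_open hα1 hL hu_sol hu_reg huh_reg huh_H10
        (hmem s hs) hg).trans ?_
      exact mul_le_mul_of_nonneg_right hgn.le (norm_nonneg _)
  exact ⟨hE.trans (mul_le_mul_left (ENNReal.ofReal_le_ofReal
    (barrier_le_rpow hα_lt ht.1)) _), hE⟩
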